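/- Let $(\mathcal C,\mathbb E,\mathfrak s)$ be an extriangulated category (in the sense of Nakaoka and Palu) with enough projectives and enough injectives. Let $\mathcal P$ and $\mathcal I$ be its full subcategories of projectives and injectives, and let $\mathcal C/[\mathcal P]$ and $\mathcal C/[\mathcal I]$ be the quotients of $\mathcal C$ by the ideals of morphisms factoring through an object of $\mathcal P$, respectively of $\mathcal I$. For a preadditive category $\mathcal A$, let $\textup{mod-}\mathcal A$ be the category of finitely presented right $\mathcal A$-modules, i.e. of additive functors $F:\mathcal A^{\textup{op}}\to Ab$ for which there is an exact sequence $\mathcal A(-,X)\to\mathcal A(-,Y)\to F\to 0$; thus the objects of $\textup{mod-}\mathcal A^{\textup{op}}$ are covariant functors $\mathcal A\to Ab$. Let $\textup{proj-}\mathcal A$ and $\textup{inj-}\mathcal A$ be the full subcategories of $\textup{mod-}\mathcal A$ consisting of its projective and of its injective objects. For an $\mathfrak s$-triangle $\delta=(X_1\xrightarrow{f_1}X_2\xrightarrow{f_2}X_3\overset{\rho}{\dashrightarrow})$ define functors $\delta^*$ and $\delta_*$ by exactness of $$\mathcal C(-,X_2)\xrightarrow{\mathcal C(-,f_2)}\mathcal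 C(-,X_3)\to\delta^*\to0,\qquad \mathcal C(X_2,-)\xrightarrow{\mathcal C(f_1,-)}\mathcal C(X_1,-)\to\delta_*\to0.$$ Since $\delta^*$ vanishes on $\mathcal P$ and $\delta_*$ vanishes on $\mathcal I$, they are regarded as objects of $\textup{mod-}\mathcal C/[\mathcal P]$ and of $\textup{mod-}(\mathcal C/[\mathcal I])^{\textup{op}}$; likewise $\mathbb E(-,X)$ and $\mathbb E(X,-)$ are regarded as functors on $\mathcal C/[\mathcal P]$ and on $\mathcal C/[\mathcal I]$. Then every object of $\textup{mod-}\mathcal C/[\mathcal P]$ is isomorphic to $\delta^*$ for some $\mathfrak s$-triangle $\delta$, and there is a duality (contravariant equivalence) $$\Phi:\textup{mod-}\mathcal C/[\mathcal P]\to\textup{mod-}(\mathcal C/[\mathcal I])^{\textup{op}},\qquad \delta^*\mapsto\delta_*,$$ that is, $\Phi(\delta^*)\cong\delta_*$ naturally in the $\mathfrak s$-triangle $\delta$. Moreover, $\Phi$ restricts to dualities $$\textup{proj-}\mathcal C/[\mathcal P]\to\textup{inj-}(\mathcal C/[\mathcal I])^{\textup{op}},\qquad \mathcal C/[\mathcal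 P](-,X)\mapsto\mathbb E(X,-),$$ $$\textup{inj-}\mathcal C/[\mathcal P]\to\textup{proj-}(\mathcal C/[\mathcal I])^{\textup{op}},\qquad \mathbb E(-,X)\mapsto\mathcal C/[\mathcal I](X,-).$$ In particular, for every $X\in\mathcal C$ the functors $\mathcal C/[\mathcal P](-,X)$, $\mathbb E(X,-)$, $\mathbb E(-,X)$, $\mathcal C/[\mathcal I](X,-)$ are objects of the categories displayed, and the isomorphisms $\Phi(\mathcal C/[\mathcal P](-,X))\cong\mathbb E(X,-)$ and $\Phi(\mathbb E(-,X))\cong\mathcal C/[\mathcal I](X,-)$ are natural in $X$. -/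

import Mathlib

open CategoryTheory CategoryTheory.Limits Opposite
open scoped ZeroObject

universe v u

set_option linter.unusedSectionVars false

noncomputable section

/-! ### Finitely presented modules over a preadditive category -/

section Modules

variable {A : Type u} [Category.{v} A] [Preadditive A]

/-- A right `A`-module, i.e. a contravariant additive functor `F` from `A` to abelian groups, is
finitely presented if there is an exact sequence `A(-, X) ⟶ A(-, Y) ⟶ F ⟶ 0` of functors. -/
structure IsFPRight (F : Aᵒᵖ ⥤ AddCommGrpCat.{v}) : Prop where
  additive : F.Additive
  presentation : ∃ (X Y : A) (g : X ⟶ Y) (π : preadditiveYoneda.obj Y ⟶ F),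
    ∀ W : Aᵒᵖ, Function.Surjective (π.app W).hom ∧
      Function.Exact ((preadditiveYoneda.map g).app W).hom (π.app W).hom

/-- A right `Aᵒᵖ`-module, i.e. a covariant additive functor `F` from `A` to abelian groups, is
finitely presented if there is an exact sequence `A(X, -) ⟶ A(Y, -) ⟶ F ⟶ 0` of functors. -/
structure IsFPLeft (F : A ⥤ AddCommGrpCat.{v}) : Prop where
  additive : F.Additive
  presentation : ∃ (X Y : A) (g : Y ⟶ X) (π : preadditiveCoyoneda.obj (op Y) ⟶ F),
    ∀ W : A, Function.Surjective (π.app W).hom ∧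
      Function.Exact ((preadditiveCoyoneda.map g.op).app W).hom (π.app W).hom

variable (A)

/-- The property of being a finitely presented right `A`-module. -/
def fpRight : ObjectProperty (Aᵒᵖ ⥤ AddCommGrpCat.{v}) := fun F => IsFPRight F

/-- The property of being a finitely presented right `Aᵒᵖ`-module. -/
def fpLeft : ObjectProperty (A ⥤ AddCommGrpCat.{v}) := fun F => IsFPLeft F

/-- The category `mod-A` of finitely presented right `A`-modules. -/
abbrev ModRight := (fpRight A).FullSubcategory

/-- The category `mod-Aᵒᵖ` of finitely presented right `Aᵒᵖ`-modules, the latter viewed as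
covariant functors on `A`. -/
abbrev ModLeft := (fpLeft A).FullSubcategory

variable {A}

lemma isFPRight_of_presentation (F : Aᵒᵖ ⥤ AddCommGrpCat.{v}) {X Y : A} (g : X ⟶ Y)
    (π : preadditiveYoneda.obj Y ⟶ F)
    (h : ∀ W : Aᵒᵖ, Function.Surjective (π.app W).hom ∧
      Function.Exact ((preadditiveYoneda.map g).app W).hom (π.app W).hom) : IsFPRight F where
  additive :=
    { map_add := by
        intro V W a b
        ext x
        obtain ⟨y, rfl⟩ := (h V).1 x
        have e : ∀ c : V ⟶ W, (F.map c).hom ((π.app V).hom y) =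
            (π.app W).hom (((preadditiveYoneda.obj Y).map c).hom y) := fun c =>
          (ConcreteCategory.congr_hom (π.naturality c) y).symm
        change (F.map (a + b)).hom _ = (F.map a).hom _ + (F.map b).hom _
        rw [e, e, e, Functor.map_add]
        exact map_add _ _ _ }
  presentation := ⟨X, Y, g, π, h⟩

lemma isFPLeft_of_presentation (F : A ⥤ AddCommGrpCat.{v}) {X Y : A} (g : Y ⟶ X)
    (π : preadditiveCoyoneda.obj (op Y) ⟶ F)
    (h : ∀ W : A, Function.Surjective (π.app W).hom ∧
      Function.Exact ((preadditiveCoyoneda.map g.op).app W).hom (π.app W).hom) : IsFPLeft F where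
  additive :=
    { map_add := by
        intro V W a b
        ext x
        obtain ⟨y, rfl⟩ := (h V).1 x
        have e : ∀ c : V ⟶ W, (F.map c).hom ((π.app V).hom y) =
            (π.app W).hom (((preadditiveCoyoneda.obj (op Y)).map c).hom y) := fun c =>
          (ConcreteCategory.congr_hom (π.naturality c) y).symm
        change (F.map (a + b)).hom _ = (F.map a).hom _ + (F.map b).hom _
        rw [e, e, e, Functor.map_add]
        exact map_add _ _ _ }
  presentation := ⟨X, Y, g, π, h⟩

variable (A)

/-- The functor `X ↦ A(-, X)` from `A` to `mod-A`. -/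
def yonedaMod : A ⥤ ModRight A :=
  (fpRight A).lift preadditiveYoneda fun X =>
    isFPRight_of_presentation _ (0 : X ⟶ X) (𝟙 _) fun _ =>
      ⟨fun x => ⟨x, rfl⟩, fun _ =>
        ⟨fun h => ⟨(0 : _ ⟶ X), (comp_zero (Z := X)).trans (Eq.symm h)⟩,
          fun ⟨_, h⟩ => (Eq.symm h).trans comp_zero⟩⟩

/-- The functor `X ↦ A(X, -)` from `Aᵒᵖ` to `mod-Aᵒᵖ`. -/
def coyonedaMod : Aᵒᵖ ⥤ ModLeft A :=
  (fpLeft A).lift preadditiveCoyoneda fun X =>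
    isFPLeft_of_presentation _ (0 : X.unop ⟶ X.unop) (𝟙 _) fun _ =>
      ⟨fun x => ⟨x, rfl⟩, fun _ =>
        ⟨fun h => ⟨(0 : X.unop ⟶ _), (zero_comp (X := X.unop)).trans (Eq.symm h)⟩,
          fun ⟨_, h⟩ => (Eq.symm h).trans zero_comp⟩⟩

lemma cokernel_app_presentation {J : Type u} [Category.{v} J] {F G : J ⥤ AddCommGrpCat.{v}}
    (g : F ⟶ G) (W : J) : Function.Surjective ((cokernel.π g).app W).hom ∧
      Function.Exact (g.app W).hom ((cokernel.π g).app W).hom := by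
  constructor
  · exact (AddCommGrpCat.epi_iff_surjective _).1 inferInstance
  · have h := (ShortComplex.exact_cokernel g).map ((evaluation J AddCommGrpCat.{v}).obj W)
    exact (ShortComplex.ab_exact_iff_function_exact _).1 h

end Modules

/-! ### The quotient of an additive category by the morphisms factoring through a subcategory -/

section IdealQuotient

variable {C : Type u} [Category.{v} C] [Preadditive C] [HasZeroObject C] [HasBinaryBiproducts C]

/-- A full subcategory containing a zero object and closed under binary direct sums. -/
class IsAdditiveSubcat (P : ObjectProperty C) : Prop where
  zero : P (0 : C)
  biprod : ∀ X Y : C, P X → P Y → P (X ⊞ Y)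

/-- The congruence modulo the ideal `[P]`: two morphisms are identified when their difference
factors through an object of `P`. -/
def idealRel (P : ObjectProperty C) : HomRel C := fun X Y f g =>
  ∃ (Z : C) (_ : P Z) (a : X ⟶ Z) (b : Z ⟶ Y), f - g = a ≫ b

lemma idealRel_add (P : ObjectProperty C) [IsAdditiveSubcat P] ⦃X Y : C⦄
    (f₁ f₂ g₁ g₂ : X ⟶ Y) (hf : idealRel P f₁ f₂) (hg : idealRel P g₁ g₂) :
    idealRel P (f₁ + g₁) (f₂ + g₂) := by
  obtain ⟨Z, hZ, a, b, h⟩ := hf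
  obtain ⟨Z', hZ', a', b', h'⟩ := hg
  refine ⟨Z ⊞ Z', IsAdditiveSubcat.biprod Z Z' hZ hZ', biprod.lift a a', biprod.desc b b', ?_⟩
  rw [biprod.lift_desc, ← h, ← h']
  abel

instance idealRel_congruence (P : ObjectProperty C) [IsAdditiveSubcat P] :
    Congruence (idealRel P) where
  equivalence :=
    { refl := fun f => ⟨0, IsAdditiveSubcat.zero, 0, 0, by simp⟩
      symm := by
        rintro f g ⟨Z, hZ, a, b, h⟩
        exact ⟨Z, hZ, -a, b, by rw [Preadditive.neg_comp, ← h, neg_sub]⟩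
      trans := by
        rintro f g k ⟨Z, hZ, a, b, h⟩ ⟨Z', hZ', a', b', h'⟩
        refine ⟨Z ⊞ Z', IsAdditiveSubcat.biprod Z Z' hZ hZ', biprod.lift a a',
          biprod.desc b b', ?_⟩
        rw [biprod.lift_desc, ← h, ← h']
        abel }
  comp_left := by
    rintro X Y Z f g g' ⟨V, hV, a, b, h⟩
    exact ⟨V, hV, f ≫ a, b, by rw [← Preadditive.comp_sub, h, Category.assoc]⟩
  comp_right := by
    rintro X Y Z f f' g ⟨V, hV, a, b, h⟩
    exact ⟨V, hV, a, b ≫ g, by rw [← Preadditive.sub_comp, h, Category.assoc]⟩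

/-- The quotient category `C/[P]`. -/
abbrev IdealQuotient (P : ObjectProperty C) := CategoryTheory.Quotient (idealRel P)

instance idealQuotientPreadditive (P : ObjectProperty C) [IsAdditiveSubcat P] :
    Preadditive (IdealQuotient P) :=
  CategoryTheory.Quotient.preadditive _ (idealRel_add P)

/-- A contravariant functor that identifies morphisms congruent modulo `[P]`, viewed as a
contravariant functor on `C/[P]`. -/
def descendRightObj (P : ObjectProperty C) (F : Cᵒᵖ ⥤ AddCommGrpCat.{v})
    (h : ∀ ⦃X Y : C⦄ (f g : X ⟶ Y), idealRel P f g → F.map f.op = F.map g.op) :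
    (IdealQuotient P)ᵒᵖ ⥤ AddCommGrpCat.{v} :=
  (CategoryTheory.Quotient.lift (idealRel P) F.rightOp fun _ _ f g r => congrArg Quiver.Hom.op (h f g r)).leftOp

/-- A covariant functor that identifies morphisms congruent modulo `[P]`, viewed as a
functor on `C/[P]`. -/
def descendLeftObj (P : ObjectProperty C) (F : C ⥤ AddCommGrpCat.{v})
    (h : ∀ ⦃X Y : C⦄ (f g : X ⟶ Y), idealRel P f g → F.map f = F.map g) :
    IdealQuotient P ⥤ AddCommGrpCat.{v} :=
  CategoryTheory.Quotient.lift (idealRel P) F fun _ _ f g r => h f g r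

/-- `descendRightObj` for a family of functors depending functorially on an object of `J`. -/
def descendRight (P : ObjectProperty C) {J : Type*} [Category* J]
    (K : J ⥤ Cᵒᵖ ⥤ AddCommGrpCat.{v})
    (h : ∀ (j : J) ⦃X Y : C⦄ (f g : X ⟶ Y), idealRel P f g →
      (K.obj j).map f.op = (K.obj j).map g.op) :
    J ⥤ (IdealQuotient P)ᵒᵖ ⥤ AddCommGrpCat.{v} where
  obj j := descendRightObj P (K.obj j) (h j)
  map φ :=
    { app := fun W => (K.map φ).app (op W.unop.as)
      naturality := by
        rintro ⟨⟨V⟩⟩ ⟨⟨W⟩⟩ ⟨⟨f⟩⟩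
        exact (K.map φ).naturality (Quiver.Hom.op f) }
  map_id j := by
    ext W : 2
    exact congrArg (fun t => NatTrans.app t (op W.unop.as)) (K.map_id j)
  map_comp φ ψ := by
    ext W : 2
    exact congrArg (fun t => NatTrans.app t (op W.unop.as)) (K.map_comp φ ψ)

/-- `descendLeftObj` for a family of functors depending functorially on an object of `J`. -/
def descendLeft (P : ObjectProperty C) {J : Type*} [Category* J]
    (K : J ⥤ C ⥤ AddCommGrpCat.{v})
    (h : ∀ (j : J) ⦃X Y : C⦄ (f g : X ⟶ Y), idealRel P f g →
      (K.obj j).map f = (K.obj j).map g) :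
    J ⥤ IdealQuotient P ⥤ AddCommGrpCat.{v} where
  obj j := descendLeftObj P (K.obj j) (h j)
  map φ :=
    { app := fun W => (K.map φ).app W.as
      naturality := by
        rintro ⟨V⟩ ⟨W⟩ ⟨f⟩
        exact (K.map φ).naturality f }
  map_id j := by
    ext W : 2
    exact congrArg (fun t => NatTrans.app t W.as) (K.map_id j)
  map_comp φ ψ := by
    ext W : 2
    exact congrArg (fun t => NatTrans.app t W.as) (K.map_comp φ ψ)

lemma map_eq_of_idealRel_right (P : ObjectProperty C) (F : Cᵒᵖ ⥤ AddCommGrpCat.{v}) [F.Additive]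
    (h : ∀ Z, P Z → ∀ x : F.obj (op Z), x = 0) ⦃X Y : C⦄ (f g : X ⟶ Y) (r : idealRel P f g) :
    F.map f.op = F.map g.op := by
  obtain ⟨Z, hZ, a, b, e⟩ := r
  rw [← sub_eq_zero, ← Functor.map_sub, ← op_sub, e, op_comp, F.map_comp]
  ext x
  change (F.map a.op).hom ((F.map b.op).hom x) = 0
  rw [h Z hZ ((F.map b.op).hom x), map_zero]

lemma map_eq_of_idealRel_left (P : ObjectProperty C) (F : C ⥤ AddCommGrpCat.{v}) [F.Additive]
    (h : ∀ Z, P Z → ∀ x : F.obj Z, x = 0) ⦃X Y : C⦄ (f g : X ⟶ Y) (r : idealRel P f g) :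
    F.map f = F.map g := by
  obtain ⟨Z, hZ, a, b, e⟩ := r
  rw [← sub_eq_zero, ← Functor.map_sub, e, F.map_comp]
  ext x
  change (F.map b).hom ((F.map a).hom x) = 0
  rw [h Z hZ ((F.map a).hom x), map_zero]

lemma isFPRight_descend (P : ObjectProperty C) [IsAdditiveSubcat P]
    (F : Cᵒᵖ ⥤ AddCommGrpCat.{v})
    (h : ∀ ⦃X Y : C⦄ (f g : X ⟶ Y), idealRel P f g → F.map f.op = F.map g.op)
    {X Y : C} (g : X ⟶ Y) (π : preadditiveYoneda.obj Y ⟶ F)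
    (hπ : ∀ W : Cᵒᵖ, Function.Surjective (π.app W).hom ∧
      Function.Exact ((preadditiveYoneda.map g).app W).hom (π.app W).hom) :
    IsFPRight (descendRightObj P F h) := by
  have hF := (isFPRight_of_presentation F g π hπ).additive
  let Q := CategoryTheory.Quotient.functor (idealRel P)
  let u : F.obj (op Y) := (π.app (op Y)).hom (𝟙 Y)
  have hu : ∀ {W : C} (k : W ⟶ Y), (F.map k.op).hom u = (π.app (op W)).hom k := fun k =>
    (ConcreteCategory.congr_hom (π.naturality k.op) (𝟙 Y)).symm.trans
      (congrArg (π.app (op _)).hom (Category.comp_id k))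
  let π' : preadditiveYoneda.obj (Q.obj Y) ⟶ descendRightObj P F h :=
    { app := fun W => AddCommGrpCat.ofHom
        (AddMonoidHom.mk' (fun k : W.unop ⟶ Q.obj Y =>
          (((descendRightObj P F h).map k.op).hom u : (descendRightObj P F h).obj W)) (by
            rintro ⟨k⟩ ⟨l⟩
            exact ConcreteCategory.congr_hom
              (hF.map_add (f := Quiver.Hom.op k) (g := Quiver.Hom.op l)) u))
      naturality := by
        rintro V W f
        ext k
        exact ConcreteCategory.congr_hom
          ((descendRightObj P F h).map_comp (Quiver.Hom.op k) f) u }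
  refine isFPRight_of_presentation _ (Q.map g) π' ?_
  rintro ⟨⟨W⟩⟩
  constructor
  · intro x
    obtain ⟨k, hk⟩ := (hπ (op W)).1 x
    exact ⟨Q.map k, (hu k).trans hk⟩
  · rintro ⟨k⟩
    constructor
    · intro hk
      obtain ⟨l, hl⟩ := ((hπ (op W)).2 k).1 ((hu k).symm.trans hk)
      exact ⟨Q.map l, congrArg (fun t => Q.map t) hl⟩
    · rintro ⟨⟨l⟩, hl⟩
      rw [← hl]
      exact (hu (W := W) (l ≫ g)).trans (((hπ (op W)).2 _).2 ⟨l, rfl⟩)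

lemma isFPLeft_descend (P : ObjectProperty C) [IsAdditiveSubcat P]
    (F : C ⥤ AddCommGrpCat.{v})
    (h : ∀ ⦃X Y : C⦄ (f g : X ⟶ Y), idealRel P f g → F.map f = F.map g)
    {X Y : C} (g : Y ⟶ X) (π : preadditiveCoyoneda.obj (op Y) ⟶ F)
    (hπ : ∀ W : C, Function.Surjective (π.app W).hom ∧
      Function.Exact ((preadditiveCoyoneda.map g.op).app W).hom (π.app W).hom) :
    IsFPLeft (descendLeftObj P F h) := by
  have hF := (isFPLeft_of_presentation F g π hπ).additive
  let Q := CategoryTheory.Quotient.functor (idealRel P)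
  let u : F.obj Y := (π.app Y).hom (𝟙 Y)
  have hu : ∀ {W : C} (k : Y ⟶ W), (F.map k).hom u = (π.app W).hom k := fun k =>
    (ConcreteCategory.congr_hom (π.naturality k) (𝟙 Y)).symm.trans
      (congrArg (π.app _).hom (Category.id_comp k))
  let π' : preadditiveCoyoneda.obj (op (Q.obj Y)) ⟶ descendLeftObj P F h :=
    { app := fun W => AddCommGrpCat.ofHom
        (AddMonoidHom.mk' (fun k : Q.obj Y ⟶ W =>
          (((descendLeftObj P F h).map k).hom u : (descendLeftObj P F h).obj W)) (by
            rintro ⟨k⟩ ⟨l⟩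
            exact ConcreteCategory.congr_hom (hF.map_add (f := k) (g := l)) u))
      naturality := by
        rintro V W f
        ext k
        exact ConcreteCategory.congr_hom ((descendLeftObj P F h).map_comp k f) u }
  refine isFPLeft_of_presentation _ (Q.map g) π' ?_
  rintro ⟨W⟩
  constructor
  · intro x
    obtain ⟨k, hk⟩ := (hπ W).1 x
    exact ⟨Q.map k, (hu k).trans hk⟩
  · rintro ⟨k⟩
    constructor
    · intro hk
      obtain ⟨l, hl⟩ := ((hπ W).2 k).1 ((hu k).symm.trans hk)
      exact ⟨Q.map l, congrArg (fun t => Q.map t) hl⟩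
    · rintro ⟨⟨l⟩, hl⟩
      rw [← hl]
      exact (hu (W := W) (g ≫ l)).trans (((hπ W).2 _).2 ⟨l, rfl⟩)

end IdealQuotient

/-! ### Extriangulated categories -/

section Extriangulated

/-- A sequence `A ⟶ B ⟶ C` with prescribed end terms. -/
structure ThreeTerm {C : Type u} [Category.{v} C] (X Z : C) where
  mid : C
  fst : X ⟶ mid
  snd : mid ⟶ Z

/-- Two sequences with the same end terms are equivalent if there is an isomorphism between the
middle terms compatible with the identities of the end terms. -/
instance threeTermSetoid {C : Type u} [Category.{v} C] (X Z : C) : Setoid (ThreeTerm X Z) where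
  r S T := ∃ b : S.mid ≅ T.mid, S.fst ≫ b.hom = T.fst ∧ b.hom ≫ T.snd = S.snd
  iseqv :=
    { refl := fun S => ⟨Iso.refl _, by simp, by simp⟩
      symm := by
        rintro S T ⟨b, h, h'⟩
        exact ⟨b.symm, by simp [← h], by simp [← h']⟩
      trans := by
        rintro S T U ⟨b, h, h'⟩ ⟨c, k, k'⟩
        exact ⟨b ≪≫ c, by simp [← k, ← h], by simp [← k', ← h']⟩ }

section Bifunctor

variable {C : Type u} [Category.{v} C] (E : Cᵒᵖ ⥤ C ⥤ AddCommGrpCat.{v})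

/-- The group `E(Z, X)` of extensions of `Z` by `X`. -/
abbrev Extension (Z X : C) : Type v := ((E.obj (op Z)).obj X : AddCommGrpCat.{v})

variable {E}

/-- `a_* δ`. -/
def extPush {Z X X' : C} (a : X ⟶ X') (δ : Extension E Z X) : Extension E Z X' :=
  ((E.obj (op Z)).map a).hom δ

/-- `c^* δ`. -/
def extPull {Z Z' X : C} (c : Z' ⟶ Z) (δ : Extension E Z X) : Extension E Z' X :=
  ((E.map c.op).app X).hom δ

/-- The direct sum `δ ⊕ δ'`, the extension with components `(δ, 0, 0, δ')`. -/
def extSum [Preadditive C] [HasBinaryBiproducts C] {Z X Z' X' : C}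
    (δ : Extension E Z X) (δ' : Extension E Z' X') : Extension E (Z ⊞ Z') (X ⊞ X') :=
  extPush biprod.inl (extPull biprod.fst δ) + extPush biprod.inr (extPull biprod.snd δ')

end Bifunctor

variable (C : Type u) [Category.{v} C] [Preadditive C] [HasZeroObject C] [HasBinaryBiproducts C]

/-- An extriangulated structure `(E, s)` on the additive category `C`
(in the sense of Nakaoka and Palu). -/
structure Extriangulation where
  /-- the bifunctor `E` -/
  E : Cᵒᵖ ⥤ C ⥤ AddCommGrpCat.{v}
  /-- additivity of `E` in the contravariant variable -/
  additive_left : E.Additive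
  /-- additivity of `E` in the covariant variable -/
  additive_right : ∀ Z : Cᵒᵖ, (E.obj Z).Additive
  /-- the realization `s`, with values equivalence classes of sequences -/
  s : ∀ {Z X : C}, Extension E Z X → _root_.Quotient (threeTermSetoid X Z)
  /-- `s` is a realization: morphisms of extensions can be realized -/
  realize : ∀ {X Y Z X' Y' Z' : C} (x : X ⟶ Y) (y : Y ⟶ Z) (δ : Extension E Z X)
    (x' : X' ⟶ Y') (y' : Y' ⟶ Z') (δ' : Extension E Z' X'),
    s δ = ⟦⟨Y, x, y⟩⟧ → s δ' = ⟦⟨Y', x', y'⟩⟧ →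
    ∀ (a : X ⟶ X') (c : Z ⟶ Z'), extPush a δ = extPull c δ' →
      ∃ b : Y ⟶ Y', x ≫ b = a ≫ x' ∧ y ≫ c = b ≫ y'
  /-- the realization is additive: zero extensions -/
  s_zero : ∀ X Z : C, s (0 : Extension E Z X) = ⟦⟨X ⊞ Z, biprod.inl, biprod.snd⟩⟧
  /-- the realization is additive: direct sums -/
  s_sum : ∀ {X Y Z X' Y' Z' : C} (x : X ⟶ Y) (y : Y ⟶ Z) (δ : Extension E Z X)
    (x' : X' ⟶ Y') (y' : Y' ⟶ Z') (δ' : Extension E Z' X'),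
    s δ = ⟦⟨Y, x, y⟩⟧ → s δ' = ⟦⟨Y', x', y'⟩⟧ →
    s (extSum δ δ') = ⟦⟨Y ⊞ Y', biprod.map x x', biprod.map y y'⟩⟧
  /-- (ET3) -/
  et3 : ∀ {X Y Z X' Y' Z' : C} (x : X ⟶ Y) (y : Y ⟶ Z) (δ : Extension E Z X)
    (x' : X' ⟶ Y') (y' : Y' ⟶ Z') (δ' : Extension E Z' X'),
    s δ = ⟦⟨Y, x, y⟩⟧ → s δ' = ⟦⟨Y', x', y'⟩⟧ →
    ∀ (a : X ⟶ X') (b : Y ⟶ Y'), x ≫ b = a ≫ x' →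
      ∃ c : Z ⟶ Z', y ≫ c = b ≫ y' ∧ extPush a δ = extPull c δ'
  /-- (ET3)ᵒᵖ -/
  et3op : ∀ {X Y Z X' Y' Z' : C} (x : X ⟶ Y) (y : Y ⟶ Z) (δ : Extension E Z X)
    (x' : X' ⟶ Y') (y' : Y' ⟶ Z') (δ' : Extension E Z' X'),
    s δ = ⟦⟨Y, x, y⟩⟧ → s δ' = ⟦⟨Y', x', y'⟩⟧ →
    ∀ (b : Y ⟶ Y') (c : Z ⟶ Z'), y ≫ c = b ≫ y' →
      ∃ a : X ⟶ X', x ≫ b = a ≫ x' ∧ extPush a δ = extPull c δ'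
  /-- (ET4) -/
  et4 : ∀ {X Y V Z W : C} (f : X ⟶ Y) (f' : Y ⟶ V) (δ : Extension E V X)
    (g : Y ⟶ Z) (g' : Z ⟶ W) (δ' : Extension E W Y),
    s δ = ⟦⟨Y, f, f'⟩⟧ → s δ' = ⟦⟨Z, g, g'⟩⟧ →
    ∃ (U : C) (h' : Z ⟶ U) (d : V ⟶ U) (e : U ⟶ W) (δ'' : Extension E U X),
      s δ'' = ⟦⟨Z, f ≫ g, h'⟩⟧ ∧ s (extPush f' δ') = ⟦⟨U, d, e⟩⟧ ∧
      f' ≫ d = g ≫ h' ∧ h' ≫ e = g' ∧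
      extPull d δ'' = δ ∧ extPush f δ'' = extPull e δ'
  /-- (ET4)ᵒᵖ -/
  et4op : ∀ {V X Y W Z : C} (f' : V ⟶ X) (f : X ⟶ Y) (δ : Extension E Y V)
    (g' : W ⟶ Y) (g : Y ⟶ Z) (δ' : Extension E Z W),
    s δ = ⟦⟨X, f', f⟩⟧ → s δ' = ⟦⟨Y, g', g⟩⟧ →
    ∃ (U : C) (d : V ⟶ U) (e : U ⟶ W) (h' : U ⟶ X) (δ'' : Extension E Z U),
      s (extPull g' δ) = ⟦⟨U, d, e⟩⟧ ∧ s δ'' = ⟦⟨X, h', f ≫ g⟩⟧ ∧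
      d ≫ h' = f' ∧ h' ≫ f = e ≫ g' ∧
      extPush e δ'' = δ' ∧ extPush d δ = extPull g δ''

variable {C}

namespace Extriangulation

variable (T : Extriangulation C)

/-- `X ⟶ Y ⟶ Z` together with `δ` is an `s`-triangle. -/
def IsTriangle {X Y Z : C} (x : X ⟶ Y) (y : Y ⟶ Z) (δ : Extension T.E Z X) : Prop :=
  T.s δ = ⟦⟨Y, x, y⟩⟧

/-- `s`-inflations. -/
def IsInflation {X Y : C} (x : X ⟶ Y) : Prop :=
  ∃ (Z : C) (y : Y ⟶ Z) (δ : Extension T.E Z X), T.IsTriangle x y δ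

/-- `s`-deflations. -/
def IsDeflation {Y Z : C} (y : Y ⟶ Z) : Prop :=
  ∃ (X : C) (x : X ⟶ Y) (δ : Extension T.E Z X), T.IsTriangle x y δ

/-- The projective objects of the extriangulated category. -/
def proj : ObjectProperty C := fun P =>
  ∀ ⦃Y Z : C⦄ (y : Y ⟶ Z), T.IsDeflation y → ∀ c : P ⟶ Z, ∃ b : P ⟶ Y, b ≫ y = c

/-- The injective objects of the extriangulated category. -/
def inj : ObjectProperty C := fun I =>
  ∀ ⦃X Y : C⦄ (x : X ⟶ Y), T.IsInflation x → ∀ a : X ⟶ I, ∃ b : Y ⟶ I, x ≫ b = a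

/-- There are enough projectives. -/
def EnoughProj : Prop :=
  ∀ Z : C, ∃ (X P : C) (x : X ⟶ P) (y : P ⟶ Z) (δ : Extension T.E Z X),
    T.proj P ∧ T.IsTriangle x y δ

/-- There are enough injectives. -/
def EnoughInj : Prop :=
  ∀ X : C, ∃ (I Z : C) (x : X ⟶ I) (y : I ⟶ Z) (δ : Extension T.E Z X),
    T.inj I ∧ T.IsTriangle x y δ

instance proj_isAdditiveSubcat : IsAdditiveSubcat T.proj where
  zero := fun _ _ _ _ _ => ⟨0, (isZero_zero C).eq_of_src _ _⟩
  biprod := by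
    intro P Q hP hQ Y Z y hy c
    obtain ⟨b, hb⟩ := hP y hy (biprod.inl ≫ c)
    obtain ⟨b', hb'⟩ := hQ y hy (biprod.inr ≫ c)
    exact ⟨biprod.desc b b', by ext <;> simp [hb, hb']⟩

instance inj_isAdditiveSubcat : IsAdditiveSubcat T.inj where
  zero := fun _ _ _ _ _ => ⟨0, (isZero_zero C).eq_of_tgt _ _⟩
  biprod := by
    intro P Q hP hQ X Y x hx a
    obtain ⟨b, hb⟩ := hP x hx (a ≫ biprod.fst)
    obtain ⟨b', hb'⟩ := hQ x hx (a ≫ biprod.snd)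
    exact ⟨biprod.lift b b', by ext <;> simp [hb, hb']⟩

/-- The category `C/[P]`, where `P` is the subcategory of projectives. -/
abbrev QuotProj := IdealQuotient T.proj

/-- The category `C/[I]`, where `I` is the subcategory of injectives. -/
abbrev QuotInj := IdealQuotient T.inj

/-! #### The category of `s`-triangles -/

/-- An `s`-triangle `X₁ ⟶ X₂ ⟶ X₃ ⇢`. -/
structure Triangle where
  {X₁ X₂ X₃ : C}
  f₁ : X₁ ⟶ X₂
  f₂ : X₂ ⟶ X₃
  δ : Extension T.E X₃ X₁
  isTriangle : T.IsTriangle f₁ f₂ δ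

variable {T}

/-- A morphism of `s`-triangles. -/
@[ext]
structure TriangleHom (S R : T.Triangle) where
  φ₁ : S.X₁ ⟶ R.X₁
  φ₂ : S.X₂ ⟶ R.X₂
  φ₃ : S.X₃ ⟶ R.X₃
  comm₁ : S.f₁ ≫ φ₂ = φ₁ ≫ R.f₁
  comm₂ : S.f₂ ≫ φ₃ = φ₂ ≫ R.f₂
  comm₃ : extPush φ₁ S.δ = extPull φ₃ R.δ

lemma extPush_id {Z X : C} (δ : Extension T.E Z X) : extPush (𝟙 X) δ = δ :=
  ConcreteCategory.congr_hom ((T.E.obj (op Z)).map_id X) δ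

lemma extPush_comp {Z X Y W : C} (a : X ⟶ Y) (b : Y ⟶ W) (δ : Extension T.E Z X) :
    extPush (a ≫ b) δ = extPush b (extPush a δ) :=
  ConcreteCategory.congr_hom ((T.E.obj (op Z)).map_comp a b) δ

lemma extPull_id {Z X : C} (δ : Extension T.E Z X) : extPull (𝟙 Z) δ = δ :=
  ConcreteCategory.congr_hom (congrArg (fun t => NatTrans.app t X) (T.E.map_id (op Z))) δ

lemma extPull_comp {Z Y W X : C} (a : W ⟶ Y) (b : Y ⟶ Z) (δ : Extension T.E Z X) :
    extPull (a ≫ b) δ = extPull a (extPull b δ) :=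
  ConcreteCategory.congr_hom (congrArg (fun t => NatTrans.app t X) (T.E.map_comp b.op a.op)) δ

lemma extPush_extPull {Z Z' X X' : C} (a : X ⟶ X') (c : Z' ⟶ Z) (δ : Extension T.E Z X) :
    extPush a (extPull c δ) = extPull c (extPush a δ) :=
  (ConcreteCategory.congr_hom ((T.E.map c.op).naturality a) δ).symm

lemma extPush_zero {Z X X' : C} (a : X ⟶ X') : extPush a (0 : Extension T.E Z X) = 0 :=
  map_zero ((T.E.obj (op Z)).map a).hom

lemma extPull_zero {Z Z' X : C} (c : Z' ⟶ Z) : extPull c (0 : Extension T.E Z X) = 0 :=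
  map_zero ((T.E.map c.op).app X).hom

/-- The category of `s`-triangles. -/
instance : Category T.Triangle where
  Hom := TriangleHom
  id S :=
    { φ₁ := 𝟙 _
      φ₂ := 𝟙 _
      φ₃ := 𝟙 _
      comm₁ := by simp
      comm₂ := by simp
      comm₃ := by rw [extPush_id, extPull_id] }
  comp α β :=
    { φ₁ := α.φ₁ ≫ β.φ₁
      φ₂ := α.φ₂ ≫ β.φ₂
      φ₃ := α.φ₃ ≫ β.φ₃
      comm₁ := by rw [← Category.assoc, α.comm₁, Category.assoc, β.comm₁, Category.assoc]
      comm₂ := by rw [← Category.assoc, α.comm₂, Category.assoc, β.comm₂, Category.assoc]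
      comm₃ := by
        rw [extPush_comp, α.comm₃, extPush_extPull, β.comm₃, ← extPull_comp] }
  id_comp _ := TriangleHom.ext (Category.id_comp _) (Category.id_comp _) (Category.id_comp _)
  comp_id _ := TriangleHom.ext (Category.comp_id _) (Category.comp_id _) (Category.comp_id _)
  assoc _ _ _ :=
    TriangleHom.ext (Category.assoc _ _ _) (Category.assoc _ _ _) (Category.assoc _ _ _)

/-! #### Vanishing of extensions -/

lemma exists_triangle {Z X : C} (δ : Extension T.E Z X) :
    ∃ (Y : C) (x : X ⟶ Y) (y : Y ⟶ Z), T.IsTriangle x y δ := by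
  obtain ⟨⟨Y, x, y⟩, h⟩ := _root_.Quotient.exists_rep (T.s δ)
  exact ⟨Y, x, y, h.symm⟩

lemma extPush_eq_zero {X Y Z : C} {x : X ⟶ Y} {y : Y ⟶ Z} {δ : Extension T.E Z X}
    (h : T.IsTriangle x y δ) : extPush x δ = 0 := by
  obtain ⟨a, ha, ha'⟩ := T.et3op x y δ _ _ (0 : Extension T.E 0 Y) h (T.s_zero Y 0)
    biprod.inl 0 (by simp)
  have : a = x := by simpa using (congrArg (· ≫ biprod.fst) ha).symm
  rw [← this, ha', extPull_zero]

lemma extPull_eq_zero {X Y Z : C} {x : X ⟶ Y} {y : Y ⟶ Z} {δ : Extension T.E Z X}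
    (h : T.IsTriangle x y δ) : extPull y δ = 0 := by
  obtain ⟨c, hc, hc'⟩ := T.et3 _ _ (0 : Extension T.E Y 0) x y δ (T.s_zero 0 Y) h
    0 biprod.snd (by simp)
  have : c = y := by simpa using congrArg (biprod.inr ≫ ·) hc
  rw [← this, ← hc', extPush_zero]

lemma ext_proj_eq_zero {P X : C} (hP : T.proj P) (δ : Extension T.E P X) : δ = 0 := by
  obtain ⟨Y, x, y, h⟩ := exists_triangle δ
  obtain ⟨b, hb⟩ := hP y ⟨X, x, δ, h⟩ (𝟙 P)
  rw [← extPull_id δ, ← hb, extPull_comp, extPull_eq_zero h, extPull_zero]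

lemma ext_inj_eq_zero {I Z : C} (hI : T.inj I) (δ : Extension T.E Z I) : δ = 0 := by
  obtain ⟨Y, x, y, h⟩ := exists_triangle δ
  obtain ⟨b, hb⟩ := hI x ⟨Z, y, δ, h⟩ (𝟙 I)
  rw [← extPush_id δ, ← hb, extPush_comp, extPush_eq_zero h, extPush_zero]

variable (T)

/-- The functor `X ↦ E(-, X)` with values in the contravariant functors on `C/[P]`. -/
def extRight : C ⥤ (T.QuotProj)ᵒᵖ ⥤ AddCommGrpCat.{v} :=
  descendRight T.proj T.E.flip fun X =>
    haveI : (T.E.flip.obj X).Additive :=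
      ⟨fun {_ _ f g} => haveI := T.additive_left
        congrArg (fun t => NatTrans.app t X) (T.E.map_add (f := f) (g := g))⟩
    map_eq_of_idealRel_right T.proj _ fun _ hZ δ => ext_proj_eq_zero hZ δ

/-- The functor `X ↦ E(X, -)` with values in the covariant functors on `C/[I]`. -/
def extLeft : Cᵒᵖ ⥤ T.QuotInj ⥤ AddCommGrpCat.{v} :=
  descendLeft T.inj T.E fun X =>
    haveI := T.additive_right X
    map_eq_of_idealRel_left T.inj _ fun _ hZ δ => ext_inj_eq_zero hZ δ

/-! #### The defects of an `s`-triangle -/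

/-- The cokernel of `C(-, X₂) ⟶ C(-, X₃)` as a functor on `C`. -/
def preContraDefect : T.Triangle ⥤ Cᵒᵖ ⥤ AddCommGrpCat.{v} where
  obj S := cokernel (preadditiveYoneda.map S.f₂)
  map {S R} φ := cokernel.map _ _ (preadditiveYoneda.map φ.φ₂) (preadditiveYoneda.map φ.φ₃) (by
    rw [← Functor.map_comp, ← Functor.map_comp, φ.comm₂])
  map_id S := by
    apply coequalizer.hom_ext
    erw [cokernel.π_desc]
    exact (congrArg (· ≫ cokernel.π _) (preadditiveYoneda.map_id S.X₃)).trans (by simp)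
  map_comp φ ψ := by
    apply coequalizer.hom_ext
    erw [cokernel.π_desc, cokernel.π_desc_assoc]
    rw [Category.assoc]
    erw [cokernel.π_desc]
    exact (congrArg (· ≫ cokernel.π _)
      (preadditiveYoneda.map_comp φ.φ₃ ψ.φ₃)).trans (Category.assoc _ _ _)

/-- The cokernel of `C(X₂, -) ⟶ C(X₁, -)` as a functor on `C`. -/
def preCovDefect : (T.Triangle)ᵒᵖ ⥤ C ⥤ AddCommGrpCat.{v} where
  obj S := cokernel (preadditiveCoyoneda.map S.unop.f₁.op)
  map {S R} φ := cokernel.map _ _ (preadditiveCoyoneda.map φ.unop.φ₂.op)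
    (preadditiveCoyoneda.map φ.unop.φ₁.op) (by
      rw [← Functor.map_comp, ← Functor.map_comp, ← op_comp, ← op_comp, φ.unop.comm₁])
  map_id S := by
    apply coequalizer.hom_ext
    erw [cokernel.π_desc]
    exact (congrArg (· ≫ cokernel.π _)
      (preadditiveCoyoneda.map_id (op S.unop.X₁))).trans (by simp)
  map_comp φ ψ := by
    apply coequalizer.hom_ext
    erw [cokernel.π_desc, cokernel.π_desc_assoc]
    rw [Category.assoc]
    erw [cokernel.π_desc]
    exact (congrArg (· ≫ cokernel.π _)
      (preadditiveCoyoneda.map_comp φ.unop.φ₁.op ψ.unop.φ₁.op)).trans (Category.assoc _ _ _)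

lemma preContraDefect_proj (S : T.Triangle) (Z : C) (hZ : T.proj Z)
    (x : (T.preContraDefect.obj S).obj (op Z)) : x = 0 := by
  have h := cokernel_app_presentation (preadditiveYoneda.map S.f₂) (op Z)
  obtain ⟨c, rfl⟩ := h.1 x
  obtain ⟨b, hb⟩ := hZ S.f₂ ⟨S.X₁, S.f₁, S.δ, S.isTriangle⟩ c
  exact (h.2 c).2 ⟨b, hb⟩

lemma preCovDefect_inj (S : (T.Triangle)ᵒᵖ) (Z : C) (hZ : T.inj Z)
    (x : (T.preCovDefect.obj S).obj Z) : x = 0 := by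
  have h := cokernel_app_presentation (preadditiveCoyoneda.map S.unop.f₁.op) Z
  obtain ⟨a, rfl⟩ := h.1 x
  obtain ⟨b, hb⟩ := hZ S.unop.f₁ ⟨S.unop.X₃, S.unop.f₂, S.unop.δ, S.unop.isTriangle⟩ a
  exact (h.2 a).2 ⟨b, hb⟩

lemma preContraDefect_map_eq (S : T.Triangle) ⦃X Y : C⦄ (f g : X ⟶ Y)
    (r : idealRel T.proj f g) :
    (T.preContraDefect.obj S).map f.op = (T.preContraDefect.obj S).map g.op :=
  haveI := (isFPRight_of_presentation (T.preContraDefect.obj S) S.f₂ (cokernel.π _)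
    (cokernel_app_presentation _)).additive
  map_eq_of_idealRel_right T.proj _ (T.preContraDefect_proj S) f g r

lemma preCovDefect_map_eq (S : (T.Triangle)ᵒᵖ) ⦃X Y : C⦄ (f g : X ⟶ Y)
    (r : idealRel T.inj f g) :
    (T.preCovDefect.obj S).map f = (T.preCovDefect.obj S).map g :=
  haveI := (isFPLeft_of_presentation (T.preCovDefect.obj S) S.unop.f₁ (cokernel.π _)
    (cokernel_app_presentation _)).additive
  map_eq_of_idealRel_left T.inj _ (T.preCovDefect_inj S) f g r

/-- The contravariant defect `δ ↦ δ^*`, viewed as a functor with values in `mod-C/[P]`. -/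
def contraDefect : T.Triangle ⥤ ModRight T.QuotProj :=
  (fpRight T.QuotProj).lift (descendRight T.proj T.preContraDefect T.preContraDefect_map_eq)
    fun S => isFPRight_descend T.proj _ (T.preContraDefect_map_eq S) S.f₂ (cokernel.π _)
      (cokernel_app_presentation _)

/-- The covariant defect `δ ↦ δ_*`, viewed as a functor with values in `mod-(C/[I])ᵒᵖ`. -/
def covDefect : (T.Triangle)ᵒᵖ ⥤ ModLeft T.QuotInj :=
  (fpLeft T.QuotInj).lift (descendLeft T.inj T.preCovDefect T.preCovDefect_map_eq)
    fun S => isFPLeft_descend T.inj _ (T.preCovDefect_map_eq S) S.unop.f₁ (cokernel.π _)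
      (cokernel_app_presentation _)

end Extriangulation

end Extriangulated

end

/-! Both defects of an `s`-triangle `X₁ ⟶ X₂ ⟶ X₃` are controlled by its extension `δ`. The functor
`δ^*` is generated by the class of the identity of `X₃`, and `k : W ⟶ X₃` kills this generator
exactly when `k^* δ = 0`. Dually, `δ_*` is generated by the class of the identity of `X₁`, and `k`
kills it exactly when `k_* δ = 0`. So `δ^*` is the image of `C(-, X₃) ⟶ E(-, X₁)` and `δ_*` is the
image of `C(X₁, -) ⟶ E(X₃, -)`.

For morphisms `φ, ψ : S ⟶ R` of triangles, the maps on contravariant defects agree iff `φ₃^* δ_R =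
ψ₃^* δ_R`, and those on covariant defects agree iff `φ₁_* δ_S = ψ₁_* δ_S`. Since `φ₁_* δ_S = φ₃^*
δ_R` for every morphism of triangles, these conditions coincide: the two defect functors define the
same congruence. Both are full, by the long exact sequences and the realization axiom. Enough
projectives makes the contravariant one essentially surjective, enough injectives the covariant one.
The category of triangles modulo the congruence (`DefectCat`) is therefore equivalent to `mod-C/[P]`
and to the opposite of `mod-(C/[I])ᵒᵖ`, and `Φ` is the composite.

A duality exchanges projectives and injectives, so only the special objects remain. A triangle `K ⟶
P ⟶ X` with `P` projective has defects `C/[P](-, X)` and `E(X, -)` and is projective in `DefectCat`;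
a triangle `X ⟶ I ⟶ L` with `I` injective has defects `E(-, X)` and `C/[I](X, -)` and is injective
there. -/

namespace Extriangulation

/-! ### Long exact sequences and construction of triangles -/

section Exactness

variable {C : Type u} [Category.{v} C] [Preadditive C] [HasZeroObject C] [HasBinaryBiproducts C]
  {T : Extriangulation C}

lemma add_extPush {Z X X' : C} (a b : X ⟶ X') (δ : Extension T.E Z X) :
    extPush (a + b) δ = extPush a δ + extPush b δ :=
  haveI := T.additive_right (op Z)
  ConcreteCategory.congr_hom ((T.E.obj (op Z)).map_add (f := a) (g := b)) δ

lemma add_extPull {Z Z' X : C} (a b : Z' ⟶ Z) (δ : Extension T.E Z X) :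
    extPull (a + b) δ = extPull a δ + extPull b δ :=
  haveI := T.additive_left
  ConcreteCategory.congr_hom
    (congrArg (fun t => NatTrans.app t X) (T.E.map_add (f := a.op) (g := b.op))) δ

lemma sub_extPush {Z X X' : C} (a b : X ⟶ X') (δ : Extension T.E Z X) :
    extPush (a - b) δ = extPush a δ - extPush b δ :=
  eq_sub_of_add_eq (by rw [← add_extPush, sub_add_cancel])

lemma sub_extPull {Z Z' X : C} (a b : Z' ⟶ Z) (δ : Extension T.E Z X) :
    extPull (a - b) δ = extPull a δ - extPull b δ :=
  eq_sub_of_add_eq (by rw [← add_extPull, sub_add_cancel])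

lemma zero_extPush {Z X X' : C} (δ : Extension T.E Z X) : extPush (0 : X ⟶ X') δ = 0 := by
  simpa using add_extPush (0 : X ⟶ X') 0 δ

lemma zero_extPull {Z Z' X : C} (δ : Extension T.E Z X) : extPull (0 : Z' ⟶ Z) δ = 0 := by
  simpa using add_extPull (0 : Z' ⟶ Z) 0 δ

variable {X Y Z : C} {x : X ⟶ Y} {y : Y ⟶ Z} {δ : Extension T.E Z X}

/-- Exactness at `C(W, Z)`: if `k^* δ = 0`, the pair `(𝟙, k)` is a morphism from the zero extension
to `δ`. Realizing it gives a map out of `X ⊞ W`, whose restriction to `W` is the lift. -/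
lemma IsTriangle.extPull_eq_zero_iff (h : T.IsTriangle x y δ) {W : C} (k : W ⟶ Z) :
    extPull k δ = 0 ↔ ∃ l : W ⟶ Y, l ≫ y = k := by
  constructor
  · intro hk
    obtain ⟨b, -, hb⟩ := T.realize _ _ (0 : Extension T.E W X) x y δ (T.s_zero X W) h (𝟙 X) k
      (by rw [extPush_zero, hk])
    exact ⟨biprod.inr ≫ b, by simp [← hb]⟩
  · rintro ⟨l, rfl⟩
    rw [extPull_comp, extPull_eq_zero h, extPull_zero]

lemma IsTriangle.extPush_eq_zero_iff (h : T.IsTriangle x y δ) {W : C} (k : X ⟶ W) :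
    extPush k δ = 0 ↔ ∃ l : Y ⟶ W, x ≫ l = k := by
  constructor
  · intro hk
    obtain ⟨b, hb, -⟩ := T.realize x y δ _ _ (0 : Extension T.E Z W) h (T.s_zero W Z) k (𝟙 Z)
      (by rw [extPull_zero, hk])
    exact ⟨b ≫ biprod.fst, by simp [reassoc_of% hb]⟩
  · rintro ⟨l, rfl⟩
    rw [extPush_comp, extPush_eq_zero h, extPush_zero]

/-- Exactness at `E(Z, W)`: realize `ε`, lift `y` through its deflation, and complete the resulting
square over `𝟙 Z` by (ET3)ᵒᵖ. -/
lemma IsTriangle.exists_extPush_eq (h : T.IsTriangle x y δ) {W : C} (ε : Extension T.E Z W)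
    (hε : extPull y ε = 0) : ∃ a : X ⟶ W, extPush a δ = ε := by
  obtain ⟨V, p, q, h'⟩ := exists_triangle ε
  obtain ⟨b, hb⟩ := (h'.extPull_eq_zero_iff y).1 hε
  obtain ⟨a, -, ha⟩ := T.et3op x y δ p q ε h h' b (𝟙 Z) (by simp [hb])
  exact ⟨a, by rw [ha, extPull_id]⟩

lemma IsTriangle.exists_extPull_eq (h : T.IsTriangle x y δ) {W : C} (ε : Extension T.E W X)
    (hε : extPush x ε = 0) : ∃ c : W ⟶ Z, extPull c δ = ε := by
  obtain ⟨V, p, q, h'⟩ := exists_triangle ε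
  obtain ⟨b, hb⟩ := (h'.extPush_eq_zero_iff x).1 hε
  obtain ⟨c, -, hc⟩ := T.et3 p q ε x y δ h' h (𝟙 X) b (by simp [hb])
  exact ⟨c, by rw [← hc, extPush_id]⟩

/-- A morphism on third terms whose composite with `S.f₂` kills the extension of `R` extends to
a morphism of triangles. -/
lemma exists_hom_of_φ₃ {S R : T.Triangle} (c : S.X₃ ⟶ R.X₃)
    (h : extPull S.f₂ (extPull c R.δ) = 0) : ∃ φ : S ⟶ R, φ.φ₃ = c := by
  obtain ⟨a, ha⟩ := S.isTriangle.exists_extPush_eq _ h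
  obtain ⟨b, hb, hb'⟩ := T.realize _ _ _ _ _ _ S.isTriangle R.isTriangle a c ha
  exact ⟨⟨a, b, c, hb, hb', ha⟩, rfl⟩

lemma exists_hom_of_φ₁ {S R : T.Triangle} (a : S.X₁ ⟶ R.X₁)
    (h : extPush R.f₁ (extPush a S.δ) = 0) : ∃ φ : S ⟶ R, φ.φ₁ = a := by
  obtain ⟨c, hc⟩ := R.isTriangle.exists_extPull_eq _ h
  obtain ⟨b, hb, hb'⟩ := T.realize _ _ _ _ _ _ S.isTriangle R.isTriangle a c hc.symm
  exact ⟨⟨a, b, c, hb, hb', hc.symm⟩, rfl⟩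

/-- The split triangle on `X ⊞ Z`, transported along a shear isomorphism. -/
lemma isTriangle_lift_desc {X Z : C} (g : X ⟶ Z) :
    T.IsTriangle (biprod.lift (𝟙 X) (-g)) (biprod.desc g (𝟙 Z)) 0 := by
  refine (T.s_zero X Z).trans (_root_.Quotient.sound ⟨
    { hom := biprod.lift biprod.fst (biprod.desc (-g) (𝟙 Z))
      inv := biprod.lift biprod.fst (biprod.desc g (𝟙 Z))
      hom_inv_id := by ext <;> simp
      inv_hom_id := by ext <;> simp }, ?_, ?_⟩)
  · ext <;> simp
  · ext <;> simp

/-- If `y` is a deflation, there is a deflation with the same image as the morphism with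
components `g` and `y`. -/
lemma exists_triangle_of_isDeflation (hy : T.IsDeflation y) {W : C} (g : W ⟶ Z) :
    ∃ (K M : C) (k : K ⟶ M) (m : M ⟶ Z) (ε : Extension T.E Z K), T.IsTriangle k m ε ∧
      ∀ {V : C} (l : V ⟶ Z), (∃ t : V ⟶ M, t ≫ m = l) ↔
        ∃ (a : V ⟶ W) (b : V ⟶ Y), a ≫ g + b ≫ y = l := by
  obtain ⟨X, x, δ, h⟩ := hy
  -- Two deflations are composed: the sum of the split `0 ⊞ W ⟶ W` with `y`, then the split
  -- deflation `(g, 𝟙) : W ⊞ Z ⟶ Z`. The summand `0` is there because `s_zero` realizes zero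
  -- extensions by biproducts.
  obtain ⟨U, -, -, h', ε, -, hε, -⟩ := T.et4op _ _ _ _ _ _
    (T.s_sum _ _ _ _ _ _ (T.s_zero 0 W) h) (isTriangle_lift_desc g)
  have hm : biprod.map (biprod.snd : (0 : C) ⊞ W ⟶ W) y ≫ biprod.desc g (𝟙 Z) =
      biprod.desc (biprod.snd ≫ g) y := by ext <;> simp
  rw [hm] at hε
  refine ⟨U, _, h', _, ε, hε, fun {V} l => ⟨?_, ?_⟩⟩
  · rintro ⟨t, rfl⟩
    refine ⟨t ≫ biprod.fst ≫ biprod.snd, t ≫ biprod.snd, ?_⟩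
    simp only [Category.assoc, ← Preadditive.comp_add]
    congr 1
    ext <;> simp
  · rintro ⟨a, b, rfl⟩
    exact ⟨biprod.lift (a ≫ biprod.inr) b, by simp [biprod.lift_desc]⟩

lemma exists_triangle_of_isInflation (hx : T.IsInflation x) {W : C} (g : X ⟶ W) :
    ∃ (M L : C) (m : X ⟶ M) (l : M ⟶ L) (ε : Extension T.E L X), T.IsTriangle m l ε ∧
      ∀ {V : C} (k : X ⟶ V), (∃ t : M ⟶ V, m ≫ t = k) ↔
        ∃ (a : W ⟶ V) (b : Y ⟶ V), g ≫ a + x ≫ b = k := by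
  obtain ⟨Z, y, δ, h⟩ := hx
  -- The shear triangle carries a minus sign in its inflation, so it is taken at `-g` to obtain `(𝟙,
  -- g)`. The sum of `x` with the split inflation `W ⟶ W ⊞ 0` is composed after it.
  have h₁ : T.IsTriangle (biprod.lift (𝟙 X) (-(-g))) (biprod.desc (-g) (𝟙 W)) 0 :=
    isTriangle_lift_desc (-g)
  obtain ⟨U, h', -, -, ε, hε, -⟩ := T.et4 _ _ _ _ _ _ h₁
    (T.s_sum _ _ _ _ _ _ h (T.s_zero W 0))
  have hm : biprod.lift (𝟙 X) (-(-g)) ≫ biprod.map x (biprod.inl : W ⟶ W ⊞ (0 : C)) =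
      biprod.lift x (g ≫ biprod.inl) := by ext <;> simp
  rw [hm] at hε
  refine ⟨_, U, _, h', ε, hε, fun {V} k => ⟨?_, ?_⟩⟩
  · rintro ⟨t, rfl⟩
    refine ⟨biprod.inl ≫ biprod.inr ≫ t, biprod.inl ≫ t, ?_⟩
    simp only [← Category.assoc, ← Preadditive.add_comp]
    congr 1
    ext <;> simp
  · rintro ⟨a, b, rfl⟩
    exact ⟨biprod.desc b (biprod.fst ≫ a), by simp [biprod.lift_desc, add_comm]⟩

end Exactness

end Extriangulation

/-! ### Functors generated by one element -/

section Cyclic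

variable {J : Type u} [Category.{v} J] [Preadditive J]

/-- The element `u` generates the functor `F`. -/
def IsGenerator (F : J ⥤ AddCommGrpCat.{v}) {Y : J} (u : F.obj Y) : Prop :=
  ∀ (W : J) (x : F.obj W), ∃ k : Y ⟶ W, (F.map k).hom u = x

variable {F G : J ⥤ AddCommGrpCat.{v}} {Y : J} {u : F.obj Y}

lemma IsGenerator.hom_ext (hu : IsGenerator F u) {α β : F ⟶ G}
    (h : (α.app Y).hom u = (β.app Y).hom u) : α = β := by
  ext W x
  obtain ⟨k, rfl⟩ := hu W x
  have e : ∀ γ : F ⟶ G, (γ.app W).hom ((F.map k).hom u) = (G.map k).hom ((γ.app Y).hom u) :=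
    fun γ => ConcreteCategory.congr_hom (γ.naturality k) u
  exact (e α).trans ((congrArg _ h).trans (e β).symm)

/-- A cyclic functor is a quotient of a representable one by the annihilator of its generator, so a
map out of it amounts to an element killed by that annihilator. -/
lemma IsGenerator.exists_hom [F.Additive] [G.Additive] (hu : IsGenerator F u) (w : G.obj Y)
    (h : ∀ {W : J} (k : Y ⟶ W), (F.map k).hom u = 0 → (G.map k).hom w = 0) :
    ∃ α : F ⟶ G, (α.app Y).hom u = w := by
  choose k hk using hu
  have add_map : ∀ {H : J ⥤ AddCommGrpCat.{v}} [H.Additive] (z : H.obj Y) {W : J} (a b : Y ⟶ W),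
      (H.map (a + b)).hom z = (H.map a).hom z + (H.map b).hom z := fun {H} _ z _ a b =>
    ConcreteCategory.congr_hom (H.map_add (f := a) (g := b)) z
  have sub_map : ∀ {H : J ⥤ AddCommGrpCat.{v}} [H.Additive] (z : H.obj Y) {W : J} (a b : Y ⟶ W),
      (H.map (a - b)).hom z = (H.map a).hom z - (H.map b).hom z := fun {H} _ z _ a b =>
    ConcreteCategory.congr_hom (H.map_sub (f := a) (g := b)) z
  have comp_map : ∀ {H : J ⥤ AddCommGrpCat.{v}} (z : H.obj Y) {V W : J} (a : Y ⟶ V) (b : V ⟶ W),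
      (H.map (a ≫ b)).hom z = (H.map b).hom ((H.map a).hom z) := fun {H} z _ _ a b =>
    ConcreteCategory.congr_hom (H.map_comp a b) z
  -- Independence of the choice of `k`; additivity and naturality of the map follow from it.
  have key : ∀ {W : J} (a b : Y ⟶ W), (F.map a).hom u = (F.map b).hom u →
      (G.map a).hom w = (G.map b).hom w := fun a b hab =>
    sub_eq_zero.1 ((sub_map w a b).symm.trans
      (h _ ((sub_map u a b).trans (sub_eq_zero.2 hab))))
  refine ⟨{ app := fun W => AddCommGrpCat.ofHom (AddMonoidHom.mk'
              (fun x => (G.map (k W x)).hom w) fun x y => ?_)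
            naturality := fun V W f => ?_ }, ?_⟩
  · exact (key _ _ ((hk _ _).trans (((add_map u _ _).trans
      (congrArg₂ _ (hk _ _) (hk _ _))).symm))).trans (add_map w _ _)
  · ext x
    exact (key _ _ ((hk _ _).trans
      ((congrArg (F.map f).hom (hk _ x)).symm.trans (comp_map u _ _).symm))).trans (comp_map w _ _)
  · refine (key (k Y u) (𝟙 Y) ((hk _ _).trans ?_)).trans ?_
    · exact (ConcreteCategory.congr_hom (F.map_id Y) u).symm
    · exact ConcreteCategory.congr_hom (G.map_id Y) w

lemma IsGenerator.exists_iso [F.Additive] [G.Additive] (hu : IsGenerator F u) {w : G.obj Y}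
    (hw : IsGenerator G w)
    (h : ∀ {W : J} (k : Y ⟶ W), (F.map k).hom u = 0 ↔ (G.map k).hom w = 0) :
    ∃ α : F ≅ G, (α.hom.app Y).hom u = w := by
  obtain ⟨α, hα⟩ := hu.exists_hom w fun k => (h k).1
  obtain ⟨β, hβ⟩ := hw.exists_hom u fun k => (h k).2
  refine ⟨⟨α, β, hu.hom_ext ?_, hw.hom_ext ?_⟩, hα⟩
  · exact (congrArg (β.app Y).hom hα).trans hβ
  · exact (congrArg (α.app Y).hom hβ).trans hα

end Cyclic

section GeneratorsOfModules

variable {A : Type u} [Category.{v} A] [Preadditive A]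

lemma isGenerator_yoneda (X : A) :
    IsGenerator (Y := op X) (preadditiveYoneda.obj X) (𝟙 X : X ⟶ X) :=
  fun _ k => ⟨Quiver.Hom.op k, Category.comp_id (X := unop _) k⟩

lemma isGenerator_coyoneda (X : A) :
    IsGenerator (Y := X) (preadditiveCoyoneda.obj (op X)) (𝟙 X : X ⟶ X) :=
  fun _ k => ⟨k, Category.id_comp (Y := _) k⟩

/-- A finitely presented right module is generated by an element with finitely generated
annihilator. -/
lemma IsFPRight.exists_generator {F : Aᵒᵖ ⥤ AddCommGrpCat.{v}} (hF : IsFPRight F) :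
    ∃ (X Y : A) (g : X ⟶ Y) (u : F.obj (op Y)), IsGenerator F u ∧
      ∀ {W : A} (k : W ⟶ Y), (F.map k.op).hom u = 0 ↔ ∃ l : W ⟶ X, l ≫ g = k := by
  obtain ⟨X, Y, g, π, h⟩ := hF.presentation
  have hu : ∀ {W : A} (k : W ⟶ Y), (F.map k.op).hom ((π.app (op Y)).hom (𝟙 Y)) =
      (π.app (op W)).hom k := fun k =>
    (ConcreteCategory.congr_hom (π.naturality k.op) (𝟙 Y)).symm.trans
      (congrArg (π.app (op _)).hom (Category.comp_id k))
  refine ⟨X, Y, g, (π.app (op Y)).hom (𝟙 Y), fun W x => ?_, fun {W} k => ?_⟩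
  · obtain ⟨k, hk⟩ := (h W).1 x
    exact ⟨Quiver.Hom.op k, (hu (W := unop W) k).trans hk⟩
  · rw [hu]
    exact (h (op W)).2 k

lemma IsFPLeft.exists_generator {F : A ⥤ AddCommGrpCat.{v}} (hF : IsFPLeft F) :
    ∃ (X Y : A) (g : Y ⟶ X) (u : F.obj Y), IsGenerator F u ∧
      ∀ {W : A} (k : Y ⟶ W), (F.map k).hom u = 0 ↔ ∃ l : X ⟶ W, g ≫ l = k := by
  obtain ⟨X, Y, g, π, h⟩ := hF.presentation
  have hu : ∀ {W : A} (k : Y ⟶ W), (F.map k).hom ((π.app Y).hom (𝟙 Y)) =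
      (π.app W).hom k := fun k =>
    (ConcreteCategory.congr_hom (π.naturality k) (𝟙 Y)).symm.trans
      (congrArg (π.app _).hom (Category.id_comp k))
  refine ⟨X, Y, g, (π.app Y).hom (𝟙 Y), fun W x => ?_, fun {W} k => ?_⟩
  · obtain ⟨k, hk⟩ := (h W).1 x
    exact ⟨k, (hu k).trans hk⟩
  · rw [hu]
    exact (h W).2 k

end GeneratorsOfModules

namespace Extriangulation

variable {C : Type u} [Category.{v} C] [Preadditive C] [HasZeroObject C] [HasBinaryBiproducts C]
  {T : Extriangulation C}

/-! ### Generators and annihilators of the two defects -/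

section Defects

variable (S : T.Triangle)

/-- The functor underlying the contravariant defect. -/
noncomputable abbrev contra : T.QuotProjᵒᵖ ⥤ AddCommGrpCat.{v} := (T.contraDefect.obj S).obj

/-- The functor underlying the covariant defect. -/
noncomputable abbrev cov : T.QuotInj ⥤ AddCommGrpCat.{v} := (T.covDefect.obj (op S)).obj

/-- The image of a morphism in `C/[P]`. -/
abbrev toQuotProj (T : Extriangulation C) {X Y : C} (f : X ⟶ Y) :
    (⟨X⟩ : T.QuotProj) ⟶ ⟨Y⟩ := (CategoryTheory.Quotient.functor (idealRel T.proj)).map f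

/-- The image of a morphism in `C/[I]`. -/
abbrev toQuotInj (T : Extriangulation C) {X Y : C} (f : X ⟶ Y) :
    (⟨X⟩ : T.QuotInj) ⟶ ⟨Y⟩ := (CategoryTheory.Quotient.functor (idealRel T.inj)).map f

/-- The class of the identity in the contravariant defect. -/
noncomputable def contraGen : (contra S).obj (op ⟨S.X₃⟩) :=
  ((cokernel.π (preadditiveYoneda.map S.f₂)).app (op S.X₃)).hom (𝟙 S.X₃)

/-- The class of the identity in the covariant defect. -/
noncomputable def covGen : (cov S).obj ⟨S.X₁⟩ :=
  ((cokernel.π (preadditiveCoyoneda.map S.f₁.op)).app S.X₁).hom (𝟙 S.X₁)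

lemma contra_map_contraGen {W : C} (k : W ⟶ S.X₃) :
    ((contra S).map (toQuotProj T k).op).hom (contraGen S) =
      ((cokernel.π (preadditiveYoneda.map S.f₂)).app (op W)).hom k :=
  (ConcreteCategory.congr_hom
    ((cokernel.π (preadditiveYoneda.map S.f₂)).naturality k.op) (𝟙 S.X₃)).symm.trans
    (congrArg ((cokernel.π (preadditiveYoneda.map S.f₂)).app (op _)).hom (Category.comp_id k))

lemma cov_map_covGen {W : C} (k : S.X₁ ⟶ W) :
    ((cov S).map (toQuotInj T k)).hom (covGen S) =
      ((cokernel.π (preadditiveCoyoneda.map S.f₁.op)).app W).hom k :=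
  (ConcreteCategory.congr_hom
    ((cokernel.π (preadditiveCoyoneda.map S.f₁.op)).naturality k) (𝟙 S.X₁)).symm.trans
    (congrArg ((cokernel.π (preadditiveCoyoneda.map S.f₁.op)).app _).hom (Category.id_comp k))

lemma isGenerator_contraGen : IsGenerator (contra S) (contraGen S) := by
  intro W x
  obtain ⟨k, hk⟩ :=
    (cokernel_app_presentation (preadditiveYoneda.map S.f₂) (op W.unop.as)).1 x
  exact ⟨(toQuotProj T (X := W.unop.as) k).op, (contra_map_contraGen S k).trans hk⟩

lemma isGenerator_covGen : IsGenerator (cov S) (covGen S) := by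
  intro W x
  obtain ⟨k, hk⟩ :=
    (cokernel_app_presentation (preadditiveCoyoneda.map S.f₁.op) W.as).1 x
  exact ⟨toQuotInj T (Y := W.as) k, (cov_map_covGen S k).trans hk⟩

/-- Both sides say that `k` factors through `S.f₂`: the left by the definition of the cokernel, the
right by the long exact sequence. This is what turns questions on defects into questions on
extensions. -/
lemma contra_map_eq_zero_iff {W : C} (k : W ⟶ S.X₃) :
    ((contra S).map (toQuotProj T k).op).hom (contraGen S) = 0 ↔ extPull k S.δ = 0 := by
  rw [contra_map_contraGen, S.isTriangle.extPull_eq_zero_iff]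
  exact (cokernel_app_presentation (preadditiveYoneda.map S.f₂) (op W)).2 k

lemma cov_map_eq_zero_iff {W : C} (k : S.X₁ ⟶ W) :
    ((cov S).map (toQuotInj T k)).hom (covGen S) = 0 ↔ extPush k S.δ = 0 := by
  rw [cov_map_covGen, S.isTriangle.extPush_eq_zero_iff]
  exact (cokernel_app_presentation (preadditiveCoyoneda.map S.f₁.op) W).2 k

instance : (contra S).Additive := (T.contraDefect.obj S).property.additive

instance : (cov S).Additive := (T.covDefect.obj (op S)).property.additive

variable {S} {R : T.Triangle}

lemma contraDefect_map_contraGen (φ : S ⟶ R) :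
    ((T.contraDefect.map φ).hom.app (op ⟨S.X₃⟩)).hom (contraGen S) =
      ((contra R).map (toQuotProj T φ.φ₃).op).hom (contraGen R) := by
  rw [contra_map_contraGen]
  have h : cokernel.π (preadditiveYoneda.map S.f₂) ≫ T.preContraDefect.map φ =
      preadditiveYoneda.map φ.φ₃ ≫ cokernel.π (preadditiveYoneda.map R.f₂) := cokernel.π_desc _ _ _
  exact (ConcreteCategory.congr_hom (congrArg (fun t => NatTrans.app t (op S.X₃)) h)
    (𝟙 S.X₃)).trans (congrArg ((cokernel.π (preadditiveYoneda.map R.f₂)).app (op S.X₃)).hom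
      (Category.id_comp φ.φ₃))

lemma covDefect_map_covGen (φ : S ⟶ R) :
    ((T.covDefect.map φ.op).hom.app ⟨R.X₁⟩).hom (covGen R) =
      ((cov S).map (toQuotInj T φ.φ₁)).hom (covGen S) := by
  rw [cov_map_covGen]
  have h : cokernel.π (preadditiveCoyoneda.map R.f₁.op) ≫ T.preCovDefect.map φ.op =
      preadditiveCoyoneda.map φ.φ₁.op ≫ cokernel.π (preadditiveCoyoneda.map S.f₁.op) :=
    cokernel.π_desc _ _ _
  exact (ConcreteCategory.congr_hom (congrArg (fun t => NatTrans.app t R.X₁) h)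
    (𝟙 R.X₁)).trans (congrArg ((cokernel.π (preadditiveCoyoneda.map S.f₁.op)).app R.X₁).hom
      (Category.comp_id φ.φ₁))

end Defects

lemma toQuotProj_surjective {X Y : C} (k : (⟨X⟩ : T.QuotProj) ⟶ ⟨Y⟩) :
    ∃ f : X ⟶ Y, toQuotProj T f = k :=
  (CategoryTheory.Quotient.functor (idealRel T.proj)).map_surjective k

lemma toQuotInj_surjective {X Y : C} (k : (⟨X⟩ : T.QuotInj) ⟶ ⟨Y⟩) :
    ∃ f : X ⟶ Y, toQuotInj T f = k :=
  (CategoryTheory.Quotient.functor (idealRel T.inj)).map_surjective k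

lemma toQuotProj_eq_iff {X Y : C} (f g : X ⟶ Y) :
    toQuotProj T f = toQuotProj T g ↔ idealRel T.proj f g :=
  CategoryTheory.Quotient.functor_map_eq_iff _ f g

lemma toQuotInj_eq_iff {X Y : C} (f g : X ⟶ Y) :
    toQuotInj T f = toQuotInj T g ↔ idealRel T.inj f g :=
  CategoryTheory.Quotient.functor_map_eq_iff _ f g

section Maps

variable (S : T.Triangle)

lemma contra_map_eq_iff {W : C} (k l : W ⟶ S.X₃) :
    ((contra S).map (toQuotProj T k).op).hom (contraGen S) =
      ((contra S).map (toQuotProj T l).op).hom (contraGen S) ↔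
      extPull k S.δ = extPull l S.δ := by
  rw [← sub_eq_zero (a := extPull k S.δ), ← sub_extPull, ← contra_map_eq_zero_iff,
    contra_map_contraGen, contra_map_contraGen, contra_map_contraGen]
  exact sub_eq_zero.symm.trans (Eq.congr_left (map_sub (AddCommGrpCat.Hom.hom
    ((cokernel.π (preadditiveYoneda.map S.f₂)).app (op W))) k l).symm)

lemma cov_map_eq_iff {W : C} (k l : S.X₁ ⟶ W) :
    ((cov S).map (toQuotInj T k)).hom (covGen S) =
      ((cov S).map (toQuotInj T l)).hom (covGen S) ↔
      extPush k S.δ = extPush l S.δ := by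
  rw [← sub_eq_zero (a := extPush k S.δ), ← sub_extPush, ← cov_map_eq_zero_iff,
    cov_map_covGen, cov_map_covGen, cov_map_covGen]
  exact sub_eq_zero.symm.trans (Eq.congr_left (map_sub (AddCommGrpCat.Hom.hom
    ((cokernel.π (preadditiveCoyoneda.map S.f₁.op)).app W)) k l).symm)

variable {S} {R : T.Triangle}

/-- A map of defects is determined by the image of the generator of its source, which here is the
class of `φ₃` in the defect of `R`. -/
lemma contraDefect_map_eq_iff (φ ψ : S ⟶ R) :
    T.contraDefect.map φ = T.contraDefect.map ψ ↔ extPull φ.φ₃ R.δ = extPull ψ.φ₃ R.δ := by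
  rw [← contra_map_eq_iff, ← contraDefect_map_contraGen, ← contraDefect_map_contraGen]
  exact ⟨fun h => by rw [h], fun h => ObjectProperty.hom_ext _ ((isGenerator_contraGen S).hom_ext h)⟩

lemma covDefect_map_eq_iff (φ ψ : S ⟶ R) :
    T.covDefect.map φ.op = T.covDefect.map ψ.op ↔ extPush φ.φ₁ S.δ = extPush ψ.φ₁ S.δ := by
  rw [← cov_map_eq_iff, ← covDefect_map_covGen, ← covDefect_map_covGen]
  exact ⟨fun h => by rw [h], fun h => ObjectProperty.hom_ext _ ((isGenerator_covGen R).hom_ext h)⟩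

end Maps

/-! ### Fullness and essential surjectivity of the defects -/

instance contraDefect_full : T.contraDefect.Full where
  map_surjective {S R} t := by
    obtain ⟨k, hk⟩ := isGenerator_contraGen R _ ((t.hom.app (op ⟨S.X₃⟩)).hom (contraGen S))
    obtain ⟨c, hc⟩ := toQuotProj_surjective k.unop
    obtain rfl : k = (toQuotProj T c).op := congrArg Quiver.Hom.op hc.symm
    -- The morphism `c` represents the image of the generator. Since `S.f₂` kills the generator of
    -- `S`, naturality of `t` shows that `S.f₂ ≫ c` kills that of `R`, which is the condition for
    -- `c` to extend to a morphism of triangles.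
    obtain ⟨φ, rfl⟩ := exists_hom_of_φ₃ (S := S) (R := R) c (by
      rw [← extPull_comp, ← contra_map_eq_zero_iff]
      have h₁ := (contra_map_eq_zero_iff S S.f₂).2 (extPull_eq_zero S.isTriangle)
      have h₂ := ConcreteCategory.congr_hom (t.hom.naturality (toQuotProj T S.f₂).op) (contraGen S)
      have h₃ := ConcreteCategory.congr_hom
        ((contra R).map_comp (toQuotProj T c).op (toQuotProj T S.f₂).op) (contraGen R)
      refine Eq.trans h₃ ((congrArg ((contra R).map (toQuotProj T S.f₂).op).hom hk).trans
        (h₂.symm.trans ((congrArg (t.hom.app _).hom h₁).trans (map_zero _))))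
      )
    exact ⟨φ, ObjectProperty.hom_ext _ ((isGenerator_contraGen S).hom_ext
      ((contraDefect_map_contraGen φ).trans hk))⟩

lemma exists_covDefect_map_eq {S R : T.Triangle}
    (t : T.covDefect.obj (op R) ⟶ T.covDefect.obj (op S)) :
    ∃ φ : S ⟶ R, T.covDefect.map φ.op = t := by
  obtain ⟨k, hk⟩ := isGenerator_covGen S _ ((t.hom.app ⟨R.X₁⟩).hom (covGen R))
  obtain ⟨a, rfl⟩ := toQuotInj_surjective k
  obtain ⟨φ, rfl⟩ := exists_hom_of_φ₁ (S := S) (R := R) a (by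
    rw [← extPush_comp, ← cov_map_eq_zero_iff]
    have h₁ := (cov_map_eq_zero_iff R R.f₁).2 (extPush_eq_zero R.isTriangle)
    have h₂ := ConcreteCategory.congr_hom (t.hom.naturality (toQuotInj T R.f₁)) (covGen R)
    have h₃ := ConcreteCategory.congr_hom
      ((cov S).map_comp (toQuotInj T a) (toQuotInj T R.f₁)) (covGen S)
    refine Eq.trans h₃ ((congrArg ((cov S).map (toQuotInj T R.f₁)).hom hk).trans
      (h₂.symm.trans ((congrArg (t.hom.app _).hom h₁).trans (map_zero _)))))
  exact ⟨φ, ObjectProperty.hom_ext _ ((isGenerator_covGen R).hom_ext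
    ((covDefect_map_covGen φ).trans hk))⟩

instance covDefect_full : T.covDefect.Full where
  map_surjective t := by
    obtain ⟨φ, hφ⟩ := exists_covDefect_map_eq t
    exact ⟨φ.op, hφ⟩

/-- A presentation over `C/[P]` is given by some `f : X ⟶ Y`, in general not a deflation. Adding a
deflation `P ⟶ Y` from a projective makes it one without changing its class modulo `[P]`, and the
resulting triangle has the required defect. -/
lemma contraDefect_essSurj (hP : T.EnoughProj) : T.contraDefect.EssSurj where
  mem_essImage F := by
    obtain ⟨⟨X⟩, ⟨Y⟩, g, w, hw, hg⟩ := F.property.exists_generator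
    obtain ⟨f, rfl⟩ := toQuotProj_surjective g
    obtain ⟨K, P, x, y, δ, hPP, h⟩ := hP Y
    obtain ⟨K', M, k, m, ε, hm, hlift⟩ := exists_triangle_of_isDeflation ⟨K, x, δ, h⟩ f
    let S : T.Triangle := ⟨k, m, ε, hm⟩
    have := F.property.additive
    obtain ⟨α, -⟩ := (isGenerator_contraGen S).exists_iso hw (fun {W} c => by
      obtain ⟨c, rfl⟩ : ∃ c' : W.unop.as ⟶ Y, c = (toQuotProj T c').op := by
        obtain ⟨c', hc⟩ := toQuotProj_surjective c.unop
        exact ⟨c', congrArg Quiver.Hom.op hc.symm⟩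
      refine (contra_map_eq_zero_iff S c).trans (.trans ?_ (hg _).symm)
      refine (hm.extPull_eq_zero_iff c).trans ((hlift c).trans ⟨?_, ?_⟩)
      · rintro ⟨a, b, rfl⟩
        refine ⟨toQuotProj T a, ((toQuotProj_eq_iff (a ≫ f) _).2 ⟨P, hPP, -b, y, ?_⟩)⟩
        simp
      · rintro ⟨l, hl⟩
        obtain ⟨a, rfl⟩ := toQuotProj_surjective l
        obtain ⟨Z, hZ, p, q, hpq⟩ := (toQuotProj_eq_iff (a ≫ f) c).1 hl
        -- Any map to `Y` from a projective lifts through `y`, so an error term in the ideal is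
        -- absorbed by the added summand.
        obtain ⟨r, rfl⟩ := hZ y ⟨K, x, δ, h⟩ q
        exact ⟨a, -(p ≫ r), by rw [Preadditive.neg_comp, Category.assoc, ← hpq]; abel⟩)
    exact ⟨S, ⟨(fpRight T.QuotProj).isoMk α⟩⟩

/-- Dually, the presenting morphism becomes an inflation once an inflation `Y ⟶ I` into an injective
is added. -/
lemma covDefect_essSurj (hI : T.EnoughInj) : T.covDefect.EssSurj where
  mem_essImage F := by
    obtain ⟨⟨X⟩, ⟨Y⟩, g, w, hw, hg⟩ := F.property.exists_generator
    obtain ⟨f, rfl⟩ := toQuotInj_surjective g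
    obtain ⟨I, L, x, y, δ, hII, h⟩ := hI Y
    obtain ⟨M, L', m, l, ε, hm, hext⟩ := exists_triangle_of_isInflation ⟨L, y, δ, h⟩ f
    let S : T.Triangle := ⟨m, l, ε, hm⟩
    have := F.property.additive
    obtain ⟨α, -⟩ := (isGenerator_covGen S).exists_iso hw (fun {W} c => by
      obtain ⟨c, rfl⟩ := toQuotInj_surjective (Y := W.as) c
      refine (cov_map_eq_zero_iff S c).trans (.trans ?_ (hg _).symm)
      refine (hm.extPush_eq_zero_iff c).trans ((hext c).trans ⟨?_, ?_⟩)
      · rintro ⟨a, b, rfl⟩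
        refine ⟨toQuotInj T a, ((toQuotInj_eq_iff (f ≫ a) _).2 ⟨I, hII, x, -b, ?_⟩)⟩
        simp
      · rintro ⟨l, hl⟩
        obtain ⟨a, rfl⟩ := toQuotInj_surjective (Y := W.as) l
        obtain ⟨Z, hZ, p, q, hpq⟩ := (toQuotInj_eq_iff (f ≫ a) c).1 hl
        obtain ⟨r, rfl⟩ := hZ x ⟨L, y, δ, h⟩ p
        exact ⟨a, -(r ≫ q), by rw [Preadditive.comp_neg, ← Category.assoc, ← hpq]; abel⟩)
    exact ⟨op S, ⟨(fpLeft T.QuotInj).isoMk α⟩⟩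

/-- The category of `s`-triangles modulo the morphisms inducing zero on defects. -/
abbrev DefectCat (T : Extriangulation C) := CategoryTheory.Quotient T.contraDefect.homRel

/-- The projection from `s`-triangles to the defect category. -/
abbrev toDefectCat (T : Extriangulation C) : T.Triangle ⥤ T.DefectCat :=
  CategoryTheory.Quotient.functor T.contraDefect.homRel

/-! ### Projective and injective objects of the defect category -/

section Morphisms

variable {S R : T.Triangle}

lemma toDefectCat_map_eq_iff (φ ψ : S ⟶ R) :
    T.toDefectCat.map φ = T.toDefectCat.map ψ ↔ extPull φ.φ₃ R.δ = extPull ψ.φ₃ R.δ :=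
  (CategoryTheory.Quotient.functor_map_eq_iff _ φ ψ).trans
    ((Functor.homRel_iff _ φ ψ).trans (contraDefect_map_eq_iff φ ψ))

lemma toDefectCat_map_eq_iff' (φ ψ : S ⟶ R) :
    T.toDefectCat.map φ = T.toDefectCat.map ψ ↔ extPush φ.φ₁ S.δ = extPush ψ.φ₁ S.δ := by
  rw [toDefectCat_map_eq_iff, φ.comm₃, ψ.comm₃]

/-- The triangle `Q` whose deflation has the image spanned by `φ₃` and `R.f₂` represents the
cokernel of `φ` on contravariant defects. As `φ` is epi, the projection `R ⟶ Q` is zero, so `𝟙 R.X₃`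
factors through that deflation. -/
lemma exists_section_of_epi (φ : S ⟶ R) (hφ : Epi (T.toDefectCat.map φ)) :
    ∃ (a : R.X₃ ⟶ S.X₃) (b : R.X₃ ⟶ R.X₂), a ≫ φ.φ₃ + b ≫ R.f₂ = 𝟙 R.X₃ := by
  obtain ⟨K, M, k, m, ε, hm, hlift⟩ :=
    exists_triangle_of_isDeflation ⟨_, _, _, R.isTriangle⟩ φ.φ₃
  let Q : T.Triangle := ⟨k, m, ε, hm⟩
  obtain ⟨χ, hχ⟩ := exists_hom_of_φ₃ (S := R) (R := Q) (𝟙 _) (by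
    rw [extPull_id]
    exact (hm.extPull_eq_zero_iff _).2 ((hlift _).2 ⟨0, 𝟙 _, by simp⟩))
  -- `DefectCat` carries no additive structure here; a morphism with third component `0` plays the
  -- role of zero.
  obtain ⟨ζ, hζ⟩ := exists_hom_of_φ₃ (S := R) (R := Q) 0 (by rw [zero_extPull, extPull_zero])
  have h : T.toDefectCat.map χ = T.toDefectCat.map ζ := by
    rw [← cancel_epi (T.toDefectCat.map φ), ← Functor.map_comp, ← Functor.map_comp,
      toDefectCat_map_eq_iff]
    change extPull (φ.φ₃ ≫ χ.φ₃) ε = extPull (φ.φ₃ ≫ ζ.φ₃) ε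
    rw [hχ, hζ, Category.comp_id, comp_zero, zero_extPull]
    exact (hm.extPull_eq_zero_iff _).2 ((hlift _).2 ⟨𝟙 _, 0, by simp⟩)
  rw [toDefectCat_map_eq_iff, hχ, hζ, zero_extPull] at h
  exact (hlift _).1 ((hm.extPull_eq_zero_iff _).1 h)

/-- The dual argument: on covariant defects `Q` represents the cokernel of the map induced by `φ`,
and `Q ⟶ S` is zero because `φ` is mono. -/
lemma exists_retraction_of_mono (φ : S ⟶ R) (hφ : Mono (T.toDefectCat.map φ)) :
    ∃ (a : R.X₁ ⟶ S.X₁) (b : S.X₂ ⟶ S.X₁), φ.φ₁ ≫ a + S.f₁ ≫ b = 𝟙 S.X₁ := by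
  obtain ⟨M, L, m, l, ε, hm, hext⟩ :=
    exists_triangle_of_isInflation ⟨_, _, _, S.isTriangle⟩ φ.φ₁
  let Q : T.Triangle := ⟨m, l, ε, hm⟩
  obtain ⟨χ, hχ⟩ := exists_hom_of_φ₁ (S := Q) (R := S) (𝟙 _) (by
    rw [extPush_id]
    exact (hm.extPush_eq_zero_iff _).2 ((hext _).2 ⟨0, 𝟙 _, by simp⟩))
  obtain ⟨ζ, hζ⟩ := exists_hom_of_φ₁ (S := Q) (R := S) 0 (by rw [zero_extPush, extPush_zero])
  have h : T.toDefectCat.map χ = T.toDefectCat.map ζ := by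
    rw [← cancel_mono (T.toDefectCat.map φ), ← Functor.map_comp, ← Functor.map_comp,
      toDefectCat_map_eq_iff']
    change extPush (χ.φ₁ ≫ φ.φ₁) ε = extPush (ζ.φ₁ ≫ φ.φ₁) ε
    rw [hχ, hζ, Category.id_comp, zero_comp, zero_extPush]
    exact (hm.extPush_eq_zero_iff _).2 ((hext _).2 ⟨𝟙 _, 0, by simp⟩)
  rw [toDefectCat_map_eq_iff', hχ, hζ, zero_extPush] at h
  exact (hext _).1 ((hm.extPush_eq_zero_iff _).1 h)

lemma projective_toDefectCat (hS : T.proj S.X₂) : Projective (T.toDefectCat.obj S) where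
  factors {E X} f e he := by
    obtain ⟨ψ, rfl⟩ := T.toDefectCat.map_surjective (X := S) (Y := X.as) f
    obtain ⟨φ, rfl⟩ := T.toDefectCat.map_surjective (X := E.as) (Y := X.as) e
    obtain ⟨a, b, hab⟩ := exists_section_of_epi φ he
    -- With `E(S.X₂, -) = 0` every map on third terms extends to triangles. The lift `ψ.φ₃ ≫ a` is
    -- correct up to `ψ.φ₃ ≫ b ≫ f₂`, and `f₂` kills the extension of the target.
    obtain ⟨θ, hθ⟩ := exists_hom_of_φ₃ (S := S) (R := E.as) (ψ.φ₃ ≫ a) (ext_proj_eq_zero hS _)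
    refine ⟨T.toDefectCat.map θ, ?_⟩
    refine (T.toDefectCat.map_comp θ φ).symm.trans ((toDefectCat_map_eq_iff _ _).2 ?_)
    change extPull (θ.φ₃ ≫ φ.φ₃) _ = _
    rw [hθ, Category.assoc, eq_sub_of_add_eq hab, Preadditive.comp_sub, sub_extPull,
      ← Category.assoc, extPull_comp (ψ.φ₃ ≫ b), extPull_eq_zero X.as.isTriangle, extPull_zero,
      sub_zero, Category.comp_id]

lemma injective_toDefectCat (hS : T.inj S.X₂) : Injective (T.toDefectCat.obj S) where
  factors {X Y} g f hf := by
    obtain ⟨ψ, rfl⟩ := T.toDefectCat.map_surjective (X := X.as) (Y := S) g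
    obtain ⟨φ, rfl⟩ := T.toDefectCat.map_surjective (X := X.as) (Y := Y.as) f
    obtain ⟨a, b, hab⟩ := exists_retraction_of_mono φ hf
    obtain ⟨θ, hθ⟩ := exists_hom_of_φ₁ (S := Y.as) (R := S) (a ≫ ψ.φ₁) (ext_inj_eq_zero hS _)
    refine ⟨T.toDefectCat.map θ, ?_⟩
    refine (T.toDefectCat.map_comp φ θ).symm.trans ((toDefectCat_map_eq_iff' _ _).2 ?_)
    change extPush (φ.φ₁ ≫ θ.φ₁) _ = _
    rw [hθ, ← Category.assoc, eq_sub_of_add_eq hab, Preadditive.sub_comp, sub_extPush,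
      Category.assoc, extPush_comp X.as.f₁, extPush_eq_zero X.as.isTriangle, extPush_zero,
      sub_zero, Category.id_comp]

end Morphisms

/-- The contravariant defect on the defect category. -/
noncomputable def contraFunctor (T : Extriangulation C) : T.DefectCat ⥤ ModRight T.QuotProj :=
  CategoryTheory.Quotient.lift T.contraDefect.homRel T.contraDefect (by simp)

/-- The covariant defect on the defect category. -/
noncomputable def covFunctor (T : Extriangulation C) : T.DefectCat ⥤ (ModLeft T.QuotInj)ᵒᵖ :=
  CategoryTheory.Quotient.lift T.contraDefect.homRel T.covDefect.rightOp
    fun S R φ ψ h => congrArg Quiver.Hom.op ((covDefect_map_eq_iff φ ψ).2 (by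
      rw [φ.comm₃, ψ.comm₃, ← contraDefect_map_eq_iff]
      exact h))

lemma contraFunctor_isEquivalence (hP : T.EnoughProj) : T.contraFunctor.IsEquivalence := by
  have := T.contraDefect_essSurj hP
  unfold contraFunctor
  infer_instance

lemma covFunctor_isEquivalence (hI : T.EnoughInj) : T.covFunctor.IsEquivalence where
  faithful :=
    { map_injective := by
        intro S R f g h
        obtain ⟨φ, rfl⟩ := T.toDefectCat.map_surjective (X := S.as) (Y := R.as) f
        obtain ⟨ψ, rfl⟩ := T.toDefectCat.map_surjective (X := S.as) (Y := R.as) g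
        -- Faithfulness rests on the compatibility `φ₁_* δ_S = φ₃^* δ_R`: the congruence defined by
        -- the contravariant defect is also that of the covariant one.
        exact (toDefectCat_map_eq_iff' φ ψ).2
          ((covDefect_map_eq_iff φ ψ).1 (Quiver.Hom.op_inj h)) }
  full :=
    { map_surjective := by
        intro S R f
        obtain ⟨φ, hφ⟩ := exists_covDefect_map_eq (S := S.as) (R := R.as) f.unop
        exact ⟨T.toDefectCat.map φ, congrArg Quiver.Hom.op hφ⟩ }
  essSurj :=
    { mem_essImage := fun F => by
        obtain ⟨S, ⟨α⟩⟩ := (T.covDefect_essSurj hI).mem_essImage F.unop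
        exact ⟨T.toDefectCat.obj S.unop, ⟨α.symm.op⟩⟩ }

/-! ### Triangles with projective or injective middle term -/

section Resolutions

variable (hP : T.EnoughProj) (hI : T.EnoughInj)

/-- A triangle `K ⟶ P ⟶ X` with `P` projective. -/
noncomputable abbrev projTriangle (X : C) : T.Triangle where
  X₁ := (hP X).choose
  X₂ := (hP X).choose_spec.choose
  X₃ := X
  f₁ := (hP X).choose_spec.choose_spec.choose
  f₂ := (hP X).choose_spec.choose_spec.choose_spec.choose
  δ := (hP X).choose_spec.choose_spec.choose_spec.choose_spec.choose
  isTriangle := (hP X).choose_spec.choose_spec.choose_spec.choose_spec.choose_spec.2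

lemma projTriangle_proj (X : C) : T.proj (projTriangle hP X).X₂ :=
  (hP X).choose_spec.choose_spec.choose_spec.choose_spec.choose_spec.1

/-- A triangle `X ⟶ I ⟶ L` with `I` injective. -/
noncomputable abbrev injTriangle (X : C) : T.Triangle where
  X₁ := X
  X₂ := (hI X).choose
  X₃ := (hI X).choose_spec.choose
  f₁ := (hI X).choose_spec.choose_spec.choose
  f₂ := (hI X).choose_spec.choose_spec.choose_spec.choose
  δ := (hI X).choose_spec.choose_spec.choose_spec.choose_spec.choose
  isTriangle := (hI X).choose_spec.choose_spec.choose_spec.choose_spec.choose_spec.2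

lemma injTriangle_inj (X : C) : T.inj (injTriangle hI X).X₂ :=
  (hI X).choose_spec.choose_spec.choose_spec.choose_spec.choose_spec.1

lemma exists_projTriangle_hom {X Y : C} (f : X ⟶ Y) :
    ∃ φ : projTriangle hP X ⟶ projTriangle hP Y, φ.φ₃ = f :=
  exists_hom_of_φ₃ (S := projTriangle hP X) (R := projTriangle hP Y) f
    (ext_proj_eq_zero (projTriangle_proj hP X) _)

lemma exists_injTriangle_hom {X Y : C} (f : X ⟶ Y) :
    ∃ φ : injTriangle hI X ⟶ injTriangle hI Y, φ.φ₁ = f :=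
  exists_hom_of_φ₁ (S := injTriangle hI X) (R := injTriangle hI Y) f
    (ext_inj_eq_zero (injTriangle_inj hI Y) _)

/-- The functor sending `X` to a triangle `K ⟶ P ⟶ X` with `P` projective. -/
noncomputable def projFunctor : C ⥤ T.DefectCat where
  obj X := T.toDefectCat.obj (projTriangle hP X)
  map f := T.toDefectCat.map (exists_projTriangle_hom hP f).choose
  map_id X := by
    -- The chosen extensions to triangles need not be functorial, but the class in `DefectCat`
    -- depends only on the third component.
    rw [← CategoryTheory.Functor.map_id, toDefectCat_map_eq_iff, (exists_projTriangle_hom hP (𝟙 X)).choose_spec]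
    rfl
  map_comp f g := by
    rw [← Functor.map_comp, toDefectCat_map_eq_iff, (exists_projTriangle_hom hP (f ≫ g)).choose_spec]
    change _ = extPull (_ ≫ _) _
    rw [(exists_projTriangle_hom hP f).choose_spec, (exists_projTriangle_hom hP g).choose_spec]

/-- The functor sending `X` to a triangle `X ⟶ I ⟶ L` with `I` injective. -/
noncomputable def injFunctor : C ⥤ T.DefectCat where
  obj X := T.toDefectCat.obj (injTriangle hI X)
  map f := T.toDefectCat.map (exists_injTriangle_hom hI f).choose
  map_id X := by
    rw [← CategoryTheory.Functor.map_id, toDefectCat_map_eq_iff', (exists_injTriangle_hom hI (𝟙 X)).choose_spec]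
    rfl
  map_comp f g := by
    rw [← Functor.map_comp, toDefectCat_map_eq_iff', (exists_injTriangle_hom hI (f ≫ g)).choose_spec]
    change _ = extPush (_ ≫ _) _
    rw [(exists_injTriangle_hom hI f).choose_spec, (exists_injTriangle_hom hI g).choose_spec]

instance (Z : C) : (T.extLeft.obj (op Z)).Additive where
  map_add {X Y} := by
    rintro ⟨f⟩ ⟨g⟩
    exact (T.additive_right (op Z)).map_add (f := f) (g := g)

instance (X : C) : (T.extRight.obj X).Additive where
  map_add := by
    rintro ⟨⟨Y⟩⟩ ⟨⟨Z⟩⟩ ⟨⟨f⟩⟩ ⟨⟨g⟩⟩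
    exact congrArg (fun t => NatTrans.app t X) (T.additive_left.map_add
      (f := Quiver.Hom.op f) (g := Quiver.Hom.op g))

/-- A morphism to `X` factors through the chosen deflation `P ⟶ X` iff it factors through some
projective, so both generators have the same annihilator. Recording the image of the generator makes
naturality in `X` checkable later. -/
lemma exists_iso_yoneda (X : C) :
    ∃ α : contra (projTriangle hP X) ≅ preadditiveYoneda.obj (⟨X⟩ : T.QuotProj),
      (α.hom.app (op ⟨X⟩)).hom (contraGen (projTriangle hP X)) = 𝟙 (⟨X⟩ : T.QuotProj) := by
  refine (isGenerator_contraGen (projTriangle hP X)).exists_iso (isGenerator_yoneda _)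
    fun {W} k => ?_
  obtain ⟨c, hc⟩ := toQuotProj_surjective (T := T) (X := W.unop.as) (Y := X) k.unop
  obtain rfl : k = (toQuotProj T c).op := congrArg Quiver.Hom.op hc.symm
  refine (contra_map_eq_zero_iff (projTriangle hP X) c).trans ?_
  rw [(projTriangle hP X).isTriangle.extPull_eq_zero_iff]
  refine Iff.trans ?_ (Eq.congr_left (Category.comp_id (toQuotProj T c)).symm)
  refine Iff.trans ?_ (toQuotProj_eq_iff c 0).symm
  constructor
  · rintro ⟨l, rfl⟩
    exact ⟨_, projTriangle_proj hP X, l, _, sub_zero _⟩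
  · rintro ⟨Z, hZ, a, b, h⟩
    obtain ⟨r, rfl⟩ := hZ (projTriangle hP X).f₂ ⟨_, _, _, (projTriangle hP X).isTriangle⟩ b
    exact ⟨a ≫ r, by rw [Category.assoc, ← h, sub_zero]⟩

lemma exists_iso_coyoneda (X : C) :
    ∃ α : cov (injTriangle hI X) ≅ preadditiveCoyoneda.obj (op (⟨X⟩ : T.QuotInj)),
      (α.hom.app ⟨X⟩).hom (covGen (injTriangle hI X)) = 𝟙 (⟨X⟩ : T.QuotInj) := by
  refine (isGenerator_covGen (injTriangle hI X)).exists_iso (isGenerator_coyoneda _)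
    fun {W} k => ?_
  obtain ⟨c, rfl⟩ := toQuotInj_surjective (T := T) (X := X) (Y := W.as) k
  refine (cov_map_eq_zero_iff (injTriangle hI X) c).trans ?_
  rw [(injTriangle hI X).isTriangle.extPush_eq_zero_iff]
  refine Iff.trans ?_ (Eq.congr_left (Category.id_comp (toQuotInj T c)).symm)
  refine Iff.trans ?_ (toQuotInj_eq_iff c 0).symm
  constructor
  · rintro ⟨l, rfl⟩
    exact ⟨_, injTriangle_inj hI X, _, l, sub_zero _⟩
  · rintro ⟨Z, hZ, a, b, h⟩
    obtain ⟨r, rfl⟩ := hZ (injTriangle hI X).f₁ ⟨_, _, _, (injTriangle hI X).isTriangle⟩ a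
    exact ⟨r ≫ b, by rw [← Category.assoc, ← h, sub_zero]⟩

/-- Since `E(P, -) = 0`, the extension `δ` of the triangle generates `E(X, -)`; its annihilator is
that of the generator of the covariant defect. -/
lemma exists_iso_extLeft (X : C) :
    ∃ α : cov (projTriangle hP X) ≅ T.extLeft.obj (op X),
      (α.hom.app ⟨(projTriangle hP X).X₁⟩).hom (covGen (projTriangle hP X)) =
        (projTriangle hP X).δ := by
  refine (isGenerator_covGen (projTriangle hP X)).exists_iso (fun W x => ?_) fun {W} k => ?_
  · obtain ⟨a, ha⟩ := (projTriangle hP X).isTriangle.exists_extPush_eq (W := W.as) x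
      (ext_proj_eq_zero (projTriangle_proj hP X) _)
    exact ⟨toQuotInj T (Y := W.as) a, ha⟩
  · obtain ⟨c, rfl⟩ := toQuotInj_surjective (T := T) (Y := W.as) k
    exact cov_map_eq_zero_iff (projTriangle hP X) c

lemma exists_iso_extRight (X : C) :
    ∃ α : contra (injTriangle hI X) ≅ T.extRight.obj X,
      (α.hom.app (op ⟨(injTriangle hI X).X₃⟩)).hom (contraGen (injTriangle hI X)) =
        (injTriangle hI X).δ := by
  refine (isGenerator_contraGen (injTriangle hI X)).exists_iso (fun W x => ?_) fun {W} k => ?_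
  · obtain ⟨a, ha⟩ := (injTriangle hI X).isTriangle.exists_extPull_eq (W := W.unop.as) x
      (ext_inj_eq_zero (injTriangle_inj hI X) _)
    exact ⟨(toQuotProj T (X := W.unop.as) a).op, ha⟩
  · obtain ⟨c, hc⟩ := toQuotProj_surjective (T := T) (X := W.unop.as) k.unop
    obtain rfl : k = (toQuotProj T c).op := congrArg Quiver.Hom.op hc.symm
    exact contra_map_eq_zero_iff (injTriangle hI X) c

end Resolutions

end Extriangulation

/-! ### Restricting a duality to full subcategories -/

instance isInjective_isClosedUnderIsomorphisms {A : Type*} [Category* A] :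
    (isInjective A).IsClosedUnderIsomorphisms where
  of_iso e h := Injective.of_iso e h

instance isProjective_isClosedUnderIsomorphisms {A : Type*} [Category* A] :
    (isProjective A).IsClosedUnderIsomorphisms where
  of_iso e h := Projective.of_iso e h

/-- A contravariant equivalence restricts to full subcategories that correspond to each other. -/
lemma exists_restricted_equivalence {A B : Type*} [Category* A] [Category* B] (Φ : Aᵒᵖ ≌ B)
    (P : ObjectProperty A) (Q : ObjectProperty B) [Q.IsClosedUnderIsomorphisms]
    (h : ∀ a, Q (Φ.functor.obj (op a)) ↔ P a) :
    ∃ Ψ : P.FullSubcategoryᵒᵖ ≌ Q.FullSubcategory,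
      Nonempty (Ψ.functor ⋙ Q.ι ≅ P.ι.op ⋙ Φ.functor) := by
  let F : P.FullSubcategoryᵒᵖ ⥤ Q.FullSubcategory :=
    Q.lift (P.ι.op ⋙ Φ.functor) fun X => (h _).2 X.unop.property
  have : F.EssSurj := ⟨fun Y => by
    let a : A := (Φ.inverse.obj Y.obj).unop
    have e : Φ.functor.obj (op a) ≅ Y.obj := Φ.counitIso.app Y.obj
    exact ⟨op ⟨a, (h a).1 (Q.prop_of_iso e.symm Y.property)⟩, ⟨Q.isoMk e⟩⟩⟩
  have : F.IsEquivalence := { }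
  exact ⟨F.asEquivalence, ⟨Q.liftCompιIso _ _⟩⟩

namespace Extriangulation

variable {C : Type u} [Category.{v} C] [Preadditive C] [HasZeroObject C] [HasBinaryBiproducts C]
  {T : Extriangulation C}

/-! ### Naturality of the identifications of the defects -/

section NaturalIsomorphisms

variable (hP : T.EnoughProj) (hI : T.EnoughInj)

lemma projFunctor_contraFunctor : Nonempty (projFunctor hP ⋙ T.contraFunctor ≅
    CategoryTheory.Quotient.functor (idealRel T.proj) ⋙ yonedaMod T.QuotProj) := by
  choose α hα using exists_iso_yoneda hP
  refine ⟨NatIso.ofComponents (fun X => (fpRight T.QuotProj).isoMk (α X)) fun {X Y} f =>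
    ObjectProperty.hom_ext _ ((isGenerator_contraGen (projTriangle hP X)).hom_ext ?_)⟩
  obtain ⟨φ, hφ, e⟩ : ∃ φ : projTriangle hP X ⟶ projTriangle hP Y, φ.φ₃ = f ∧
      (projFunctor hP).map f = T.toDefectCat.map φ :=
    ⟨_, (exists_projTriangle_hom hP f).choose_spec, rfl⟩
  change ((α Y).hom.app (op ⟨X⟩)).hom ((((T.contraFunctor.map
    ((projFunctor hP).map f))).hom.app (op ⟨X⟩)).hom (contraGen (projTriangle hP X))) =
    (((preadditiveYoneda.map (toQuotProj T f)).app (op ⟨X⟩)).hom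
      (((α X).hom.app (op ⟨X⟩)).hom (contraGen (projTriangle hP X))))
  rw [e]
  refine (congrArg ((α Y).hom.app (op ⟨X⟩)).hom (contraDefect_map_contraGen φ)).trans ?_
  rw [hα X, hφ]
  refine (ConcreteCategory.congr_hom ((α Y).hom.naturality (toQuotProj T f).op) _).trans ?_
  refine (congrArg ((preadditiveYoneda.obj (⟨Y⟩ : T.QuotProj)).map
    (toQuotProj T f).op).hom (hα Y)).trans ?_
  exact (Category.comp_id (toQuotProj T f)).trans (Category.id_comp (toQuotProj T f)).symm

lemma projFunctor_covFunctor : Nonempty ((projFunctor hP).op ⋙ T.covFunctor.leftOp ⋙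
    (fpLeft T.QuotInj).ι ≅ T.extLeft) := by
  choose α hα using exists_iso_extLeft hP
  refine ⟨NatIso.ofComponents (fun X => α X.unop) fun {Y X} f =>
    (isGenerator_covGen (projTriangle hP Y.unop)).hom_ext ?_⟩
  obtain ⟨φ, hφ, e⟩ : ∃ φ : projTriangle hP X.unop ⟶ projTriangle hP Y.unop, φ.φ₃ = f.unop ∧
      (projFunctor hP).map f.unop = T.toDefectCat.map φ :=
    ⟨_, (exists_projTriangle_hom hP f.unop).choose_spec, rfl⟩
  change ((α X.unop).hom.app ⟨(projTriangle hP Y.unop).X₁⟩).hom ((((T.covFunctor.map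
    ((projFunctor hP).map f.unop)).unop).hom.app ⟨(projTriangle hP Y.unop).X₁⟩).hom
      (covGen (projTriangle hP Y.unop))) =
    ((T.extLeft.map f).app ⟨(projTriangle hP Y.unop).X₁⟩).hom
      (((α Y.unop).hom.app ⟨(projTriangle hP Y.unop).X₁⟩).hom (covGen (projTriangle hP Y.unop)))
  rw [e]
  refine (congrArg ((α X.unop).hom.app _).hom (covDefect_map_covGen φ)).trans ?_
  rw [hα Y.unop]
  refine (ConcreteCategory.congr_hom
    ((α X.unop).hom.naturality (toQuotInj T φ.φ₁)) _).trans ?_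
  refine (congrArg ((T.extLeft.obj (op X.unop)).map (toQuotInj T φ.φ₁)).hom
    (hα X.unop)).trans ?_
  -- On generators, naturality in `X` is the identity `φ₁_* δ_X = φ₃^* δ_Y` between the extensions
  -- of the chosen triangles.
  refine φ.comm₃.trans ?_
  rw [hφ]
  rfl

lemma injFunctor_contraFunctor : Nonempty (injFunctor hI ⋙ T.contraFunctor ⋙
    (fpRight T.QuotProj).ι ≅ T.extRight) := by
  choose α hα using exists_iso_extRight hI
  refine ⟨NatIso.ofComponents (fun X => α X) fun {X Y} f =>
    (isGenerator_contraGen (injTriangle hI X)).hom_ext ?_⟩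
  obtain ⟨φ, hφ, e⟩ : ∃ φ : injTriangle hI X ⟶ injTriangle hI Y, φ.φ₁ = f ∧
      (injFunctor hI).map f = T.toDefectCat.map φ :=
    ⟨_, (exists_injTriangle_hom hI f).choose_spec, rfl⟩
  change ((α Y).hom.app (op ⟨(injTriangle hI X).X₃⟩)).hom (((T.contraFunctor.map
    ((injFunctor hI).map f)).hom.app (op ⟨(injTriangle hI X).X₃⟩)).hom
      (contraGen (injTriangle hI X))) =
    ((T.extRight.map f).app (op ⟨(injTriangle hI X).X₃⟩)).hom
      (((α X).hom.app (op ⟨(injTriangle hI X).X₃⟩)).hom (contraGen (injTriangle hI X)))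
  rw [e]
  refine (congrArg ((α Y).hom.app _).hom (contraDefect_map_contraGen φ)).trans ?_
  rw [hα X]
  refine (ConcreteCategory.congr_hom
    ((α Y).hom.naturality (toQuotProj T φ.φ₃).op) _).trans ?_
  refine (congrArg ((T.extRight.obj Y).map (toQuotProj T φ.φ₃).op).hom (hα Y)).trans ?_
  refine φ.comm₃.symm.trans ?_
  rw [hφ]
  rfl

lemma injFunctor_covFunctor : Nonempty ((injFunctor hI).op ⋙ T.covFunctor.leftOp ≅
    (CategoryTheory.Quotient.functor (idealRel T.inj)).op ⋙ coyonedaMod T.QuotInj) := by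
  choose α hα using exists_iso_coyoneda hI
  refine ⟨NatIso.ofComponents (fun X => (fpLeft T.QuotInj).isoMk (α X.unop)) fun {Y X} f =>
    ObjectProperty.hom_ext _ ((isGenerator_covGen (injTriangle hI Y.unop)).hom_ext ?_)⟩
  obtain ⟨φ, hφ, e⟩ : ∃ φ : injTriangle hI X.unop ⟶ injTriangle hI Y.unop, φ.φ₁ = f.unop ∧
      (injFunctor hI).map f.unop = T.toDefectCat.map φ :=
    ⟨_, (exists_injTriangle_hom hI f.unop).choose_spec, rfl⟩
  change ((α X.unop).hom.app ⟨Y.unop⟩).hom ((((T.covFunctor.map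
    ((injFunctor hI).map f.unop)).unop).hom.app ⟨Y.unop⟩).hom (covGen (injTriangle hI Y.unop))) =
    (((preadditiveCoyoneda.map (toQuotInj T f.unop).op).app ⟨Y.unop⟩).hom
      (((α Y.unop).hom.app ⟨Y.unop⟩).hom (covGen (injTriangle hI Y.unop))))
  rw [e]
  refine (congrArg ((α X.unop).hom.app ⟨Y.unop⟩).hom (covDefect_map_covGen φ)).trans ?_
  rw [hα Y.unop, hφ]
  refine (ConcreteCategory.congr_hom
    ((α X.unop).hom.naturality (toQuotInj T f.unop)) _).trans ?_
  refine (congrArg ((preadditiveCoyoneda.obj (op (⟨X.unop⟩ : T.QuotInj))).map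
    (toQuotInj T f.unop)).hom (hα X.unop)).trans ?_
  exact (Category.id_comp (toQuotInj T f.unop)).trans (Category.comp_id (toQuotInj T f.unop)).symm

end NaturalIsomorphisms

end Extriangulation

theorem mainTheorem5 {C : Type u} [Category.{v} C] [Preadditive C] [HasZeroObject C]
    [HasBinaryBiproducts C] (T : Extriangulation C) (hP : T.EnoughProj) (hI : T.EnoughInj) :
    T.contraDefect.EssSurj ∧
    ∃ Φ : (ModRight T.QuotProj)ᵒᵖ ≌ ModLeft T.QuotInj,
      Nonempty (T.contraDefect.op ⋙ Φ.functor ≅ T.covDefect) ∧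
      (∃ Φ₁ : (isProjective (ModRight T.QuotProj)).FullSubcategoryᵒᵖ ≌
            (isInjective (ModLeft T.QuotInj)).FullSubcategory,
        Nonempty (Φ₁.functor ⋙ (isInjective (ModLeft T.QuotInj)).ι ≅
          (isProjective (ModRight T.QuotProj)).ι.op ⋙ Φ.functor) ∧
        ∃ p : C ⥤ (isProjective (ModRight T.QuotProj)).FullSubcategory,
          Nonempty (p ⋙ (isProjective (ModRight T.QuotProj)).ι ≅
            CategoryTheory.Quotient.functor (idealRel T.proj) ⋙ yonedaMod T.QuotProj) ∧
          Nonempty (p.op ⋙ Φ₁.functor ⋙ (isInjective (ModLeft T.QuotInj)).ι ⋙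
            (fpLeft T.QuotInj).ι ≅ T.extLeft)) ∧
      (∃ Φ₂ : (isInjective (ModRight T.QuotProj)).FullSubcategoryᵒᵖ ≌
            (isProjective (ModLeft T.QuotInj)).FullSubcategory,
        Nonempty (Φ₂.functor ⋙ (isProjective (ModLeft T.QuotInj)).ι ≅
          (isInjective (ModRight T.QuotProj)).ι.op ⋙ Φ.functor) ∧
        ∃ q : C ⥤ (isInjective (ModRight T.QuotProj)).FullSubcategory,
          Nonempty (q ⋙ (isInjective (ModRight T.QuotProj)).ι ⋙ (fpRight T.QuotProj).ι ≅
            T.extRight) ∧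
          Nonempty (q.op ⋙ Φ₂.functor ⋙ (isProjective (ModLeft T.QuotInj)).ι ≅
            (CategoryTheory.Quotient.functor (idealRel T.inj)).op ⋙ coyonedaMod T.QuotInj)) := by
  have := Extriangulation.contraFunctor_isEquivalence hP
  have := Extriangulation.covFunctor_isEquivalence hI
  let Φ : (ModRight T.QuotProj)ᵒᵖ ≌ ModLeft T.QuotInj :=
    T.contraFunctor.asEquivalence.op.symm.trans T.covFunctor.leftOp.asEquivalence
  -- As `Φ` is a quasi-inverse of `contraFunctor` followed by `covFunctor`, the unit cancels.
  -- Restricting `e` along the projection from triangles gives `Φ(δ^*) ≅ δ_*`, naturally in `δ`.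
  let e : T.contraFunctor.op ⋙ Φ.functor ≅ T.covFunctor.leftOp :=
    Functor.isoWhiskerRight T.contraFunctor.asEquivalence.op.unitIso.symm T.covFunctor.leftOp
  obtain ⟨Φ₁, ⟨i₁⟩⟩ := exists_restricted_equivalence Φ (isProjective (ModRight T.QuotProj))
    (isInjective (ModLeft T.QuotInj)) fun F =>
      (Φ.map_injective_iff (op F)).trans Injective.projective_iff_injective_op.symm
  obtain ⟨Φ₂, ⟨i₂⟩⟩ := exists_restricted_equivalence Φ (isInjective (ModRight T.QuotProj))
    (isProjective (ModLeft T.QuotInj)) fun F =>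
      (Φ.map_projective_iff (op F)).trans Injective.injective_iff_projective_op.symm
  let p : C ⥤ (isProjective (ModRight T.QuotProj)).FullSubcategory :=
    ObjectProperty.lift _ (Extriangulation.projFunctor hP ⋙ T.contraFunctor) fun X =>
      -- Projectivity is verified in `DefectCat` and transported along the equivalence.
      (T.contraFunctor.asEquivalence.map_projective_iff _).2
        (Extriangulation.projective_toDefectCat (Extriangulation.projTriangle_proj hP X))
  let q : C ⥤ (isInjective (ModRight T.QuotProj)).FullSubcategory :=
    ObjectProperty.lift _ (Extriangulation.injFunctor hI ⋙ T.contraFunctor) fun X =>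
      (T.contraFunctor.asEquivalence.map_injective_iff _).2
        (Extriangulation.injective_toDefectCat (Extriangulation.injTriangle_inj hI X))
  obtain ⟨p₁⟩ := Extriangulation.projFunctor_contraFunctor hP
  obtain ⟨p₂⟩ := Extriangulation.projFunctor_covFunctor hP
  obtain ⟨q₁⟩ := Extriangulation.injFunctor_contraFunctor hI
  obtain ⟨q₂⟩ := Extriangulation.injFunctor_covFunctor hI
  let p' : p.op ⋙ Φ₁.functor ⋙ (isInjective (ModLeft T.QuotInj)).ι ≅
      (Extriangulation.projFunctor hP).op ⋙ T.covFunctor.leftOp :=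
    Functor.isoWhiskerLeft p.op i₁ ≪≫ Functor.isoWhiskerLeft (Extriangulation.projFunctor hP).op e
  let q' : q.op ⋙ Φ₂.functor ⋙ (isProjective (ModLeft T.QuotInj)).ι ≅
      (Extriangulation.injFunctor hI).op ⋙ T.covFunctor.leftOp :=
    Functor.isoWhiskerLeft q.op i₂ ≪≫ Functor.isoWhiskerLeft (Extriangulation.injFunctor hI).op e
  exact ⟨T.contraDefect_essSurj hP, Φ, ⟨Functor.isoWhiskerLeft T.toDefectCat.op e⟩,
    ⟨Φ₁, ⟨i₁⟩, p, ⟨p₁⟩, ⟨Functor.isoWhiskerRight p' (fpLeft T.QuotInj).ι ≪≫ p₂⟩⟩,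
    ⟨Φ₂, ⟨i₂⟩, q, ⟨q₁⟩, ⟨q' ≪≫ q₂⟩⟩⟩
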